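/- **Theorem 1.** Let $G$ be an open-loop transfer function: a function meromorphic in a neighbourhood of the closed right half plane $\{\operatorname{Re}s\ge 0\}$ for which there are $n\in\mathbb N$ and $C,R\in\mathbb R$ with $|G(s)|\le C|s|^n$ whenever $\operatorname{Re}s\ge0$ and $|s|\ge R$ (for instance $G(s)=R_0(s)e^{-\tau s}$ with $R_0$ rational, of any relative degree, and a delay $\tau\ge0$). Let $g=\frac{1}{1+G}$ be the sensitivity function of the feedback loop, regarded as a meromorphic function (removable singularities removed), and suppose that the loop is well posed in the sense that $g(x)$ grows at most polynomially as $x\to+\infty$ along the real axis (this is automatic for $G(s)=R_0(s)e^{-\tau s}$ with $1+G\not\equiv0$). Suppose that $g$ has in the open right half plane exactly the zeros $\alpha_1,\dots,\alpha_M$ and exactly the poles $\beta_1,\dots,\beta_N$ (finitely many, possibly none, listed with multiplicity); zeros and poles on the imaginary axis are allowed. (a) Let $\sigma>0$, $\eta\in\mathbb R$, and suppose that $s_0=\sigma+j\eta$ is none of the $\alpha_i,\beta_i$. Then the following integral converges absolutely and $$\int_{-\infty}^{\infty}\log|g(j\omega)|\,\frac{\sigma}{\sigma^2+(\omega-\eta)^2}\,d\omega=-\pi\left(-\log|g(s_0)|+\sum_{i=1}^{M}\log\left|\frac{s_0-\alpha_i}{s_0+\bar\alpha_i}\right|+\sum_{i=1}^{N}\log\left|\frac{s_0+\bar\beta_i}{s_0-\beta_i}\right|\right).$$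 (b) If $\zeta=\sigma+j\eta$ with $\sigma>0$ is a (non-minimum phase) zero of $G$, then $g(\zeta)=1$, the integral converges absolutely, and $$\int_{-\infty}^{\infty}\log|g(j\omega)|\,\frac{\sigma}{\sigma^2+(\omega-\eta)^2}\,d\omega=-\pi\left(\sum_{i=1}^{M}\log\left|\frac{\zeta-\alpha_i}{\zeta+\bar\alpha_i}\right|+\sum_{i=1}^{N}\log\left|\frac{\zeta+\bar\beta_i}{\zeta-\beta_i}\right|\right).$$ -/

import Mathlib

open MeasureTheory Filter Asymptotics

/-- The open right half plane. -/
def openRHP : Set ℂ := {s | 0 < s.re}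

/-- The closed right half plane (without the point at infinity). -/
def closedRHP : Set ℂ := {s | 0 ≤ s.re}

/-- The open-loop transfer functions: meromorphic at every point of the closed right half plane
(so in a neighbourhood of it), and of at most polynomial growth, of arbitrary degree, at infinity
in the closed right half plane. Every function `R(s) * exp(-τ s)` with `R` rational, of any
relative degree, and delay `τ ≥ 0` is of this kind. -/
def IsTransferFunction (G : ℂ → ℂ) : Prop :=
  MeromorphicOn G closedRHP ∧
    ∃ (n : ℕ) (C R : ℝ), ∀ s ∈ closedRHP, R ≤ ‖s‖ → ‖G s‖ ≤ C * ‖s‖ ^ n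

/-- The sensitivity function `g = 1 / (1 + G)`, as a meromorphic function: removable singularities
on the closed right half plane are removed (`g = 0` at a pole of `G`). -/
noncomputable def sensitivity (G : ℂ → ℂ) : ℂ → ℂ :=
  toMeromorphicNFOn (fun s => 1 / (1 + G s)) closedRHP

/-- Well-posedness of the loop: along the positive real axis the sensitivity function grows at
most polynomially, so closing the loop does not produce a time advance. It excludes degenerate
loops such as `1 + G(s) = exp(-s)`, and is automatic for `G(s) = R(s) * exp(-τ s)` with `R`
rational, `τ ≥ 0` and `1 + G` not identically zero. -/
def IsWellPosed (G : ℂ → ℂ) : Prop :=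
  ∃ n : ℕ, (fun x : ℝ => sensitivity G (x : ℂ)) =O[atTop] fun x : ℝ => x ^ n

/-- `a` lists the zeros of the meromorphic function `f` in the open right half plane, each as often
as its multiplicity; in particular `f` does not vanish identically there. -/
def ListsZeros (f : ℂ → ℂ) {m : ℕ} (a : Fin m → ℂ) : Prop :=
  (∀ i, a i ∈ openRHP) ∧
    ∀ s ∈ openRHP, max (meromorphicOrderAt f s) 0 = ((Nat.card {i // a i = s} : ℤ) : WithTop ℤ)

/-- `b` lists the poles of the meromorphic function `f` in the open right half plane, each as often
as its multiplicity: these are the zeros of `1 / f`. -/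
def ListsPoles (f : ℂ → ℂ) {n : ℕ} (b : Fin n → ℂ) : Prop :=
  ListsZeros f⁻¹ b

/-! Put f = 1/g, which agrees with 1 + G off isolated points: in the open half plane its zeros are
the β and its poles the α, and log|f| = -log|g|. Multiply f by the Blaschke product of the α, divide
by that of the β, and multiply by a factor Q that cancels the poles on the imaginary axis and the
polynomial growth. The resulting h is analytic on the closed half plane, zero-free in the open one,
and log|h| is bounded above. Blaschke factors have modulus one on the axis, so log|f| = log|h| -
log|Q| almost everywhere there. Subtracting the Poisson formulas for h and Q gives the one for f,
and the Blaschke products at s₀ give the two sums (`poisson_jensen_rightHalfPlane`).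

The Poisson formula needs a growth condition: exp(-cs) with c > 0 is bounded and zero-free, yet has
modulus one on the axis. After a Cayley transform to the disc, C - log|H| is a nonnegative harmonic
function, so it should be the Poisson integral of a positive measure. Away from the point 1, the
image of infinity, H is analytic across the circle and its zeros there give only integrable
logarithmic singularities, so the measure has the boundary values as density. Only an atom at 1 can
remain (`log_norm_eq_poisson_integral_sub_point_mass`). This is proved directly from Poisson's
formula on circles of radius r < 1, with the kernel reduced by its value at 1 so that mass escaping
to 1 is harmless.

In the half plane the atom contributes -c Re s. Polynomial growth of g on the positive real axis
keeps f from decaying exponentially there and forces c = 0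
(`integrable_and_integral_log_norm_mul_poisson`). -/

/-! ### Domination of log‖H‖ on circles approaching the unit circle -/

open Metric Set Real Topology InnerProductSpace in
/-- Radial approach to a boundary point is controlled by the tangential distance. -/
theorem abs_log_norm_radial_sub_le {ζ ζ₀ : ℂ} (hζ : ‖ζ‖ = 1) (hζ₀ : ‖ζ₀‖ = 1) (hne : ζ ≠ ζ₀)
    {r : ℝ} (hr₀ : 0 ≤ r) (hr₁ : r ≤ 1) :
    |Real.log ‖r * ζ - ζ₀‖| ≤ Real.log 2 + |Real.log ‖ζ - ζ₀‖| := by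
  have hr : ‖(r : ℂ) * ζ‖ = r := by simp [hζ, abs_of_nonneg hr₀]
  have h1 : 1 - r ≤ ‖r * ζ - ζ₀‖ := by
    have := norm_sub_norm_le ζ₀ (r * ζ)
    rw [hr, hζ₀, norm_sub_rev] at this
    exact this
  -- The radial displacement 1 - r is itself at most ‖rζ - ζ₀‖, whence the factor 2.
  have h2 : ‖ζ - ζ₀‖ ≤ 2 * ‖r * ζ - ζ₀‖ := by
    have h3 : ‖ζ - r * ζ‖ = 1 - r := by
      rw [show ζ - r * ζ = ((1 - r : ℝ) : ℂ) * ζ by push_cast; ring, norm_mul, hζ, mul_one,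
        Complex.norm_real, Real.norm_eq_abs, abs_of_nonneg (by linarith)]
    have := norm_add_le (ζ - r * ζ) (r * ζ - ζ₀)
    rw [show ζ - r * ζ + (r * ζ - ζ₀) = ζ - ζ₀ by ring] at this
    linarith
  have hpos : 0 < ‖ζ - ζ₀‖ := norm_pos_iff.2 (sub_ne_zero.2 hne)
  have hpos' : 0 < ‖r * ζ - ζ₀‖ := by linarith
  have h4 : ‖r * ζ - ζ₀‖ ≤ 2 := by
    have := norm_sub_le (r * ζ) ζ₀
    rw [hr, hζ₀] at this
    linarith
  rw [abs_le]
  constructor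
  · have := Real.log_le_log hpos h2
    rw [Real.log_mul two_ne_zero hpos'.ne'] at this
    have := neg_abs_le (Real.log ‖ζ - ζ₀‖)
    linarith
  · have := Real.log_le_log hpos' h4
    have := abs_nonneg (Real.log ‖ζ - ζ₀‖)
    linarith

/-- A property that holds on a punctured neighbourhood of every point of `T` holds a.e. on `T`. -/
theorem ae_of_forall_eventually_nhdsNE {T : Set ℝ} {p : ℝ → Prop}
    (h : ∀ t ∈ T, ∀ᶠ x in nhdsWithin t {t}ᶜ, p x) : ∀ᵐ t, t ∈ T → p t := by
  rw [ae_iff]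
  apply measure_null_of_locally_null
  intro t ht
  simp only [Classical.not_imp, Set.mem_ofPred_eq] at ht
  have h1 := h t ht.1
  rw [eventually_nhdsWithin_iff] at h1
  refine ⟨_, inter_mem_nhdsWithin _ h1, measure_mono_null ?_ (measure_singleton t)⟩
  rintro x ⟨hx1, hx2⟩
  simp only [Classical.not_imp, Set.mem_ofPred_eq] at hx1
  by_contra hx
  exact hx1.2 (hx2 hx)

open Metric Set Real Topology InnerProductSpace in
theorem circleMap_zero_one_ne_one {θ : ℝ} (hθ : θ ∈ Ioo 0 (2 * π)) : circleMap 0 1 θ ≠ 1 := by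
  intro h
  have h1 : circleMap 0 1 θ = circleMap 0 1 0 := by rw [h]; simp [circleMap]
  rw [circleMap_eq_circleMap_iff] at h1
  · obtain ⟨n, hn⟩ := h1
    have h2 : θ = n * (2 * π) := by
      have h3 : (θ : ℂ) = ((n * (2 * π) : ℝ) : ℂ) := by
        apply mul_right_cancel₀ Complex.I_ne_zero
        rw [hn]; push_cast; ring
      exact_mod_cast h3
    have hp : 0 < 2 * π := by positivity
    have h4 : (0 : ℝ) < n := by
      by_contra hc; push Not at hc
      have := mul_nonpos_of_nonpos_of_nonneg hc hp.le
      linarith [hθ.1]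
    have h5 : (n : ℝ) < 1 := by
      by_contra hc; push Not at hc
      have := mul_le_mul_of_nonneg_right hc hp.le
      linarith [hθ.2]
    norm_cast at h4 h5
    omega
  · norm_num

open Metric Set Real Topology InnerProductSpace in
/-- Near a unit point at which `H` is analytic and not locally zero, the radial restrictions of
`log ‖H‖` are dominated by an integrable function. -/
theorem exists_nhds_dominating_log_norm_radial {H : ℂ → ℂ} {θ₀ : ℝ}
    (hH : AnalyticAt ℂ H (circleMap 0 1 θ₀))
    (hH₀ : ¬ ∀ᶠ z in 𝓝 (circleMap 0 1 θ₀), H z = 0) :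
    ∃ S ∈ 𝓝 θ₀, ∃ B : ℝ → ℝ, IntegrableOn B (Ioo 0 (2 * π)) ∧ (∀ θ, 0 ≤ B θ) ∧
      ∀ᶠ r : ℝ in 𝓝[<] 1, ∀ᵐ θ, θ ∈ S → |Real.log ‖H (circleMap 0 r θ)‖| ≤ B θ := by
  set ζ₀ := circleMap 0 1 θ₀ with hζ₀
  have hnorm : ∀ θ, ‖circleMap 0 1 θ‖ = 1 := fun θ => by simp
  -- Locally H = (z - ζ₀)^n K with K(ζ₀) ≠ 0, so log‖H‖ is n log‖z - ζ₀‖ plus a bounded term.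
  obtain ⟨n, K, hK, hK₀, hHK⟩ := (hH.exists_eventuallyEq_pow_smul_nonzero_iff).2 hH₀
  have hcont : ContinuousAt (fun z => Real.log ‖K z‖) ζ₀ :=
    (hK.continuousAt.norm).log (norm_ne_zero_iff.2 hK₀)
  have h1 : ∀ᶠ z in 𝓝 ζ₀, |Real.log ‖K z‖| < |Real.log ‖K ζ₀‖| + 1 :=
    hcont.abs.eventually_lt continuousAt_const (by simp)
  have h2 : ∀ᶠ z in 𝓝 ζ₀, K z ≠ 0 := hK.continuousAt.eventually_ne hK₀
  obtain ⟨ε, hε, hball⟩ := Metric.eventually_nhds_iff_ball.1 (hHK.and (h1.and h2))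
  refine ⟨circleMap 0 1 ⁻¹' ball ζ₀ (ε / 2), ?_,
    fun θ => n * (Real.log 2 + |Real.log ‖circleMap 0 1 θ - ζ₀‖|) + (|Real.log ‖K ζ₀‖| + 1),
    ?_, ?_, ?_⟩
  · exact (continuous_circleMap 0 1).continuousAt.preimage_mem_nhds (ball_mem_nhds _ (by positivity))
  · have h3 : CircleIntegrable (fun z => Real.log ‖z - ζ₀‖) 0 1 :=
      circleIntegrable_log_norm_sub_const 1
    have h4 : IntegrableOn (fun θ => Real.log ‖circleMap 0 1 θ - ζ₀‖) (Ioo 0 (2 * π)) := by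
      have := (intervalIntegrable_iff_integrableOn_Ioo_of_le (by positivity)).1 h3
      exact this
    have hc (c : ℝ) : IntegrableOn (fun _ : ℝ => c) (Ioo 0 (2 * π)) := integrableOn_const (measure_Ioo_lt_top.ne)
    exact (((hc (Real.log 2)).add h4.abs).const_mul (n : ℝ)).add (hc _)
  · intro θ
    have : 0 ≤ Real.log 2 := Real.log_nonneg (by norm_num)
    positivity
  · have h5 : ∀ᶠ r : ℝ in 𝓝[<] 1, max 0 (1 - ε / 2) < r :=
      mem_of_superset (Ioo_mem_nhdsLT (show max 0 (1 - ε / 2) < 1 by simp [hε])) fun r hr => hr.1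
    -- At ζ₀ itself the majorant is finite, as `Real.log 0 = 0`, and cannot serve for all r; this
    -- null set is discarded.
    have h6 : ∀ᵐ θ : ℝ, circleMap 0 1 θ ∉ ({ζ₀} : Set ℂ) := by
      rw [ae_iff]
      simp only [not_not]
      exact ((countable_singleton ζ₀).preimage_circleMap 0 one_ne_zero).measure_zero _
    filter_upwards [h5, self_mem_nhdsWithin] with r hr hr1
    filter_upwards [h6] with θ hθ hθS
    have hr0 : 0 < r := (le_max_left _ _).trans_lt hr
    have hr2 : 1 - ε / 2 < r := (le_max_right _ _).trans_lt hr
    have hr1 : r < 1 := hr1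
    have hrz : circleMap 0 r θ = r * circleMap 0 1 θ := by simp [circleMap]
    have hmem : circleMap 0 r θ ∈ ball ζ₀ ε := by
      rw [mem_ball, dist_eq_norm, hrz]
      have h7 : ‖circleMap 0 1 θ - ζ₀‖ < ε / 2 := by
        simpa [mem_ball, dist_eq_norm] using hθS
      have h8 : ‖r * circleMap 0 1 θ - circleMap 0 1 θ‖ = 1 - r := by
        rw [show (r : ℂ) * circleMap 0 1 θ - circleMap 0 1 θ = ((r - 1 : ℝ) : ℂ) * circleMap 0 1 θ by
          push_cast; ring, norm_mul, hnorm, mul_one, Complex.norm_real, Real.norm_eq_abs,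
          abs_of_nonpos (by linarith)]
        ring
      have := norm_add_le (r * circleMap 0 1 θ - circleMap 0 1 θ) (circleMap 0 1 θ - ζ₀)
      rw [sub_add_sub_cancel] at this
      linarith
    obtain ⟨e1, e2, e3⟩ := hball _ hmem
    have hne : circleMap 0 1 θ ≠ ζ₀ := hθ
    have e4 := abs_log_norm_radial_sub_le (hnorm θ) (hnorm θ₀) hne hr0.le hr1.le
    rw [← hrz, ← hζ₀] at e4
    have hne' : circleMap 0 r θ - ζ₀ ≠ 0 := by
      intro h0
      have : ‖circleMap 0 r θ‖ = ‖ζ₀‖ := by rw [sub_eq_zero.1 h0]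
      rw [hζ₀, hnorm, norm_circleMap_zero, abs_of_pos hr0] at this
      exact hr1.ne this
    rw [e1, norm_smul, norm_pow, Real.log_mul (by positivity) (norm_ne_zero_iff.2 e3), Real.log_pow]
    refine (abs_add_le _ _).trans (add_le_add ?_ e2.le)
    rw [abs_mul, Nat.abs_cast]
    gcongr

-- Local majorants add up over a finite cover of K, by compactness.
open Metric Set Real Topology InnerProductSpace in
theorem exists_dominating_log_norm_radial {H : ℂ → ℂ} {K : Set ℝ} (hKc : IsCompact K)
    (hH : ∀ θ ∈ K, AnalyticAt ℂ H (circleMap 0 1 θ))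
    (hH₀ : ∀ θ ∈ K, ¬ ∀ᶠ z in 𝓝 (circleMap 0 1 θ), H z = 0) :
    ∃ B : ℝ → ℝ, IntegrableOn B (Ioo 0 (2 * π)) ∧ (∀ θ, 0 ≤ B θ) ∧
      ∀ᶠ r : ℝ in 𝓝[<] 1, ∀ᵐ θ, θ ∈ K → |Real.log ‖H (circleMap 0 r θ)‖| ≤ B θ := by
  refine hKc.induction_on (p := fun S => ∃ B : ℝ → ℝ, IntegrableOn B (Ioo 0 (2 * π)) ∧
    (∀ θ, 0 ≤ B θ) ∧ ∀ᶠ r : ℝ in 𝓝[<] 1, ∀ᵐ θ, θ ∈ S → |Real.log ‖H (circleMap 0 r θ)‖| ≤ B θ)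
    ⟨fun _ => 0, integrableOn_zero, fun _ => le_rfl, by simp⟩ ?_ ?_ ?_
  · rintro s t hst ⟨B, hB, hB0, h⟩
    refine ⟨B, hB, hB0, ?_⟩
    filter_upwards [h] with r hr
    filter_upwards [hr] with θ hθ hs using hθ (hst hs)
  · rintro s t ⟨B, hB, hB0, h⟩ ⟨B', hB', hB0', h'⟩
    refine ⟨fun θ => B θ + B' θ, hB.add hB', fun θ => add_nonneg (hB0 θ) (hB0' θ), ?_⟩
    filter_upwards [h, h'] with r hr hr'
    filter_upwards [hr, hr'] with θ hθ hθ' hs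
    rcases hs with hs | hs
    · linarith [hθ hs, hB0' θ]
    · linarith [hθ' hs, hB0 θ]
  · intro θ hθ
    obtain ⟨S, hS, B, h⟩ := exists_nhds_dominating_log_norm_radial (hH θ hθ) (hH₀ θ hθ)
    exact ⟨S, mem_nhdsWithin_of_mem_nhds hS, B, h⟩

/-! ### Limits of integrals with bounded mass -/

/-- Fatou's lemma for real-valued nonnegative functions with bounded integrals. -/
theorem integrable_and_integral_le_of_tendsto_of_nonneg {μ : Measure ℝ} {F : ℕ → ℝ → ℝ}
    {f : ℝ → ℝ} {A : ℝ} (hlim : ∀ᵐ x ∂μ, Tendsto (fun n => F n x) atTop (nhds (f x)))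
    (hF : ∀ n, Integrable (F n) μ) (hF₀ : ∀ n, 0 ≤ᵐ[μ] F n) (hA : ∀ n, ∫ x, F n x ∂μ ≤ A) :
    Integrable f μ ∧ 0 ≤ᵐ[μ] f ∧ ∫ x, f x ∂μ ≤ A := by
  have h1 : ∀ n, ∫⁻ x, ‖F n x‖ₑ ∂μ ≤ ENNReal.ofReal A := by
    intro n
    have : ∫⁻ x, ‖F n x‖ₑ ∂μ = ENNReal.ofReal (∫ x, F n x ∂μ) := by
      rw [ofReal_integral_eq_lintegral_ofReal (hF n) (hF₀ n)]
      refine lintegral_congr_ae ?_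
      filter_upwards [hF₀ n] with x hx
      exact Real.enorm_of_nonneg hx
    rw [this]
    exact ENNReal.ofReal_le_ofReal (hA n)
  have h2 : ∫⁻ x, ‖f x‖ₑ ∂μ ≤ ENNReal.ofReal A := by
    refine (lintegral_enorm_le_liminf_of_tendsto hlim fun n => (hF n).1.aemeasurable.enorm).trans ?_
    exact (liminf_le_liminf (Eventually.of_forall h1)).trans_eq (by simp)
  have hf : Integrable f μ :=
    ⟨aestronglyMeasurable_of_tendsto_ae _ (fun n => (hF n).1) hlim, h2.trans_lt ENNReal.ofReal_lt_top⟩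
  have hf₀ : 0 ≤ᵐ[μ] f := by
    filter_upwards [hlim, ae_all_iff.2 hF₀] with x hx hx0
    exact ge_of_tendsto' hx hx0
  refine ⟨hf, hf₀, ?_⟩
  have hA0 : 0 ≤ A := (integral_nonneg_of_ae (hF₀ 0)).trans (hA 0)
  rw [← ENNReal.ofReal_le_ofReal_iff hA0, ofReal_integral_eq_lintegral_ofReal hf hf₀]
  refine le_trans (le_of_eq (lintegral_congr_ae ?_)) h2
  filter_upwards [hf₀] with x hx
  exact (Real.enorm_of_nonneg hx).symm

/-- Integrals against a weight that is small off sets on which there is convergence. -/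
theorem tendsto_integral_mul_of_small_off {α : Type*} [MeasurableSpace α] {μ : Measure α}
    {F : ℕ → α → ℝ} {f p : α → ℝ} {A M : ℝ}
    (hp : AEStronglyMeasurable p μ) (hpM : ∀ᵐ x ∂μ, |p x| ≤ M)
    (hF : ∀ n, Integrable (F n) μ) (hF₀ : ∀ n, 0 ≤ᵐ[μ] F n) (hA : ∀ n, ∫ x, F n x ∂μ ≤ A)
    (hf : Integrable f μ) (hf₀ : 0 ≤ᵐ[μ] f) (hfA : ∫ x, f x ∂μ ≤ A)
    (hK : ∀ ε > 0, ∃ K : Set α, MeasurableSet K ∧ (∀ᵐ x ∂μ, x ∉ K → |p x| ≤ ε) ∧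
      Tendsto (fun n => ∫ x in K, p x * F n x ∂μ) atTop (nhds (∫ x in K, p x * f x ∂μ))) :
    Tendsto (fun n => ∫ x, p x * F n x ∂μ) atTop (nhds (∫ x, p x * f x ∂μ)) := by
  have hA0 : 0 ≤ A := (integral_nonneg_of_ae hf₀).trans hfA
  have hint : ∀ u : α → ℝ, Integrable u μ → Integrable (fun x => p x * u x) μ := fun u hu =>
    hu.bdd_mul hp (by simpa using hpM)
  have hoff : ∀ (ε : ℝ) (K : Set α), 0 ≤ ε → MeasurableSet K → (∀ᵐ x ∂μ, x ∉ K → |p x| ≤ ε) →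
      ∀ u : α → ℝ, Integrable u μ → 0 ≤ᵐ[μ] u → ∫ x, u x ∂μ ≤ A →
      |∫ x in Kᶜ, p x * u x ∂μ| ≤ ε * A := by
    intro ε K hε hKm hKε u hu hu0 huA
    have h1 : ‖∫ x in Kᶜ, p x * u x ∂μ‖ ≤ ∫ x in Kᶜ, ε * u x ∂μ := by
      refine norm_integral_le_of_norm_le (hu.const_mul ε).integrableOn ?_
      rw [ae_restrict_iff' hKm.compl]
      filter_upwards [hKε, hu0] with x hx hx0 hxK
      rw [Real.norm_eq_abs, abs_mul, abs_of_nonneg hx0]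
      exact mul_le_mul_of_nonneg_right (hx hxK) hx0
    refine h1.trans ?_
    rw [integral_const_mul]
    exact mul_le_mul_of_nonneg_left ((setIntegral_le_integral hu hu0).trans huA) hε
  rw [Metric.tendsto_atTop]
  intro ε hε
  -- Each of the two integrals over the complement is then below ε/4, leaving ε/2 for K; A + 1
  -- allows A = 0.
  obtain ⟨K, hKm, hKε, hKt⟩ := hK (ε / (4 * (A + 1))) (by positivity)
  obtain ⟨N, hN⟩ := Metric.tendsto_atTop.1 hKt (ε / 2) (by positivity)
  refine ⟨N, fun n hn => ?_⟩
  have e1 := hoff _ K (by positivity) hKm hKε (F n) (hF n) (hF₀ n) (hA n)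
  have e2 := hoff _ K (by positivity) hKm hKε f hf hf₀ hfA
  have e3 := hN n hn
  rw [Real.dist_eq] at e3 ⊢
  rw [← integral_add_compl hKm (hint _ (hF n)), ← integral_add_compl hKm (hint _ hf)]
  have e4 : ε / (4 * (A + 1)) * A < ε / 4 := by
    rw [div_mul_eq_mul_div, div_lt_div_iff₀ (by positivity) (by positivity)]
    nlinarith
  rw [abs_le] at e1 e2
  rw [abs_lt] at e3 ⊢
  constructor <;> linarith [e1.1, e1.2, e2.1, e2.2, e3.1, e3.2]

/-! ### The Poisson kernel of the unit disc -/

open Metric Set Real Topology InnerProductSpace in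
theorem continuous_poissonKernel_circleMap {w : ℂ} (hw : ‖w‖ < 1) :
    Continuous fun θ => poissonKernel 0 w (circleMap 0 1 θ) := by
  simp only [poissonKernel_def, sub_zero]
  refine Continuous.div (by fun_prop) (by fun_prop) fun θ => ?_
  have : circleMap 0 1 θ - w ≠ 0 := fun h => by
    have h1 : ‖circleMap 0 1 θ‖ = ‖w‖ := by rw [sub_eq_zero.1 h]
    rw [norm_circleMap_zero, abs_one] at h1
    exact hw.ne' h1
  positivity

open Metric Set Real Topology InnerProductSpace in
theorem poissonKernel_circleMap_nonneg {w : ℂ} (hw : ‖w‖ < 1) (θ : ℝ) :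
    0 ≤ poissonKernel 0 w (circleMap 0 1 θ) := by
  simp only [poissonKernel_def, sub_zero, norm_circleMap_zero, abs_one]
  have : ‖w‖ ^ 2 ≤ 1 := pow_le_one₀ (norm_nonneg _) hw.le
  have : 0 ≤ (1 : ℝ) ^ 2 - ‖w‖ ^ 2 := by linarith
  positivity

open Metric Set Real Topology InnerProductSpace in
/-- The Poisson formula on the circle of radius `r < 1`, rescaled to the unit circle. -/
theorem integral_poissonKernel_mul_radial {G : ℂ → ℝ} (hG : ∀ z, ‖z‖ < 1 → HarmonicAt G z)
    {r : ℝ} (hr₀ : 0 < r) (hr₁ : r < 1) {w : ℂ} (hw : ‖w‖ < 1) :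
    ∫ θ in Ioo 0 (2 * π), poissonKernel 0 w (circleMap 0 1 θ) * G (circleMap 0 r θ) =
      2 * π * G (r * w) := by
  have hrw : (r * w : ℂ) ∈ ball (0 : ℂ) r := by
    rw [mem_ball_zero_iff, norm_mul, Complex.norm_real, Real.norm_eq_abs, abs_of_pos hr₀]
    nlinarith
  have hGr : HarmonicOnNhd G (closedBall 0 r) := fun z hz =>
    hG z ((mem_closedBall_zero_iff.1 hz).trans_lt hr₁)
  have h1 := hGr.circleAverage_poissonKernel_smul hrw
  rw [circleAverage_def, smul_eq_mul, inv_mul_eq_iff_eq_mul₀ (by positivity),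
    intervalIntegral.integral_of_le (by positivity), integral_Ioc_eq_integral_Ioo] at h1
  rw [← h1]
  congr 1 with θ
  simp only [Pi.smul_apply', smul_eq_mul]
  congr 1
  have h2 : circleMap 0 r θ = r * circleMap 0 1 θ := by simp [circleMap]
  simp only [poissonKernel_def, sub_zero, h2, ← mul_sub, norm_mul, mul_pow]
  have h3 : ‖(r : ℂ)‖ ^ 2 ≠ 0 := by simp [hr₀.ne']
  rw [mul_div_mul_left _ _ h3]

open Set Real InnerProductSpace in
theorem integral_poissonKernel_circleMap {w : ℂ} (hw : ‖w‖ < 1) :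
    ∫ θ in Ioo 0 (2 * π), poissonKernel 0 w (circleMap 0 1 θ) = 2 * π := by
  have := integral_poissonKernel_mul_radial (G := fun _ => 1) (fun z _ => harmonicAt_const 1)
    (r := 1 / 2) (by norm_num) (by norm_num) hw
  simpa using this

theorem poissonKernel_zero_zero_circleMap (θ : ℝ) : poissonKernel 0 0 (circleMap 0 1 θ) = 1 := by
  simp [poissonKernel_def]

open Metric Set Real Topology InnerProductSpace in
theorem integrableOn_comp_circleMap_of_harmonicAt {G : ℂ → ℝ}
    (hG : ∀ z, ‖z‖ < 1 → HarmonicAt G z) {r : ℝ} (hr₀ : 0 < r) (hr₁ : r < 1) :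
    IntegrableOn (fun θ => G (circleMap 0 r θ)) (Ioo 0 (2 * π)) := by
  have h : Continuous fun θ => G (circleMap 0 r θ) := by
    rw [continuous_iff_continuousAt]
    intro θ
    have h1 : ContinuousAt G (circleMap 0 r θ) :=
      (hG _ (by rwa [norm_circleMap_zero, abs_of_pos hr₀])).1.continuousAt
    exact ContinuousAt.comp (f := circleMap 0 r) h1 (continuous_circleMap 0 r).continuousAt
  exact (h.integrableOn_Icc (a := 0) (b := 2 * π)).mono_set Ioo_subset_Icc_self

/-! ### Poisson representation in the disc with an atom at 1 -/

open Metric Set Real Topology InnerProductSpace in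
/-- An analytic function without zeros in the unit disc and bounded there, which extends
analytically across the unit circle except at `1`: the logarithm of its modulus is the Poisson
integral of its boundary values, minus a multiple of the Poisson kernel of the point `1`. -/
theorem log_norm_eq_poisson_integral_sub_point_mass {H : ℂ → ℂ} {C : ℝ}
    (hH : ∀ z, ‖z‖ ≤ 1 → z ≠ 1 → AnalyticAt ℂ H z) (hne : ∀ z, ‖z‖ < 1 → H z ≠ 0)
    (hb : ∀ z, ‖z‖ ≤ 1 → z ≠ 1 → Real.log ‖H z‖ ≤ C) :
    IntegrableOn (fun θ => Real.log ‖H (circleMap 0 1 θ)‖) (Ioo 0 (2 * π)) ∧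
    ∃ c : ℝ, 0 ≤ c ∧ ∀ w, ‖w‖ < 1 → Real.log ‖H w‖ =
      (2 * π)⁻¹ * (∫ θ in Ioo 0 (2 * π),
        poissonKernel 0 w (circleMap 0 1 θ) * Real.log ‖H (circleMap 0 1 θ)‖) -
      c * poissonKernel 0 w 1 := by
  set G : ℂ → ℝ := fun z => C - Real.log ‖H z‖ with hGdef
  have lt_ne : ∀ z : ℂ, ‖z‖ < 1 → z ≠ 1 := fun z hz h => by simp [h] at hz
  have hG : ∀ z, ‖z‖ < 1 → HarmonicAt G z := fun z hz =>
    (harmonicAt_const C).sub ((hH z hz.le (lt_ne z hz)).harmonicAt_log_norm (hne z hz))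
  have hG₀ : ∀ z, ‖z‖ ≤ 1 → z ≠ 1 → 0 ≤ G z := fun z h1 h2 => sub_nonneg.2 (hb z h1 h2)
  set r : ℕ → ℝ := fun n => 1 - 1 / ((n : ℝ) + 2) with hrdef
  have hr₀ : ∀ n, 0 < r n := fun n => by
    have : (0 : ℝ) ≤ n := n.cast_nonneg
    rw [hrdef]; simp only [sub_pos]; rw [div_lt_one (by positivity)]; linarith
  have hr₁ : ∀ n, r n < 1 := fun n => by
    rw [hrdef]; simp only [sub_lt_self_iff]; positivity
  have hr : Tendsto r atTop (𝓝 1) := by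
    have h1 : Tendsto (fun n : ℕ => 1 / ((n : ℝ) + 2)) atTop (𝓝 0) :=
      tendsto_const_nhds.div_atTop (tendsto_natCast_atTop_atTop.atTop_add tendsto_const_nhds)
    simpa [hrdef] using h1.const_sub 1
  have hr' : Tendsto r atTop (𝓝[<] 1) :=
    tendsto_nhdsWithin_iff.2 ⟨hr, Eventually.of_forall hr₁⟩
  -- Otherwise H would vanish at interior points on the same radius.
  have hnotzero : ∀ θ : ℝ, ¬ ∀ᶠ z in 𝓝 (circleMap 0 1 θ), H z = 0 := by
    intro θ h
    have h1 : Tendsto (fun n => (r n : ℂ) * circleMap 0 1 θ) atTop (𝓝 (circleMap 0 1 θ)) := by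
      have := ((Complex.continuous_ofReal.tendsto 1).comp hr).mul_const (circleMap 0 1 θ)
      simpa using this
    obtain ⟨n, hn⟩ := (h1.eventually h).exists
    refine hne _ ?_ hn
    rw [norm_mul, norm_circleMap_zero, abs_one, mul_one, Complex.norm_real, Real.norm_eq_abs,
      abs_of_pos (hr₀ n)]
    exact hr₁ n
  have hHc : ∀ θ ∈ Ioo 0 (2 * π), AnalyticAt ℂ H (circleMap 0 1 θ) := fun θ hθ =>
    hH _ (by simp) (circleMap_zero_one_ne_one hθ)
  have hae : ∀ᵐ θ : ℝ, θ ∈ Ioo 0 (2 * π) → H (circleMap 0 1 θ) ≠ 0 := by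
    refine ae_of_forall_eventually_nhdsNE fun θ hθ => ?_
    have h1 := ((hHc θ hθ).eventually_eq_zero_or_eventually_ne_zero).resolve_left (hnotzero θ)
    have hd : HasDerivAt (circleMap 0 1) (circleMap 0 1 θ * Complex.I) θ := hasDerivAt_circleMap 0 1 θ
    have h2 := hd.eventually_ne (c := circleMap 0 1 θ) (by simp [circleMap])
    have h3 : Tendsto (circleMap 0 1) (𝓝[≠] θ) (𝓝[≠] (circleMap 0 1 θ)) :=
      tendsto_nhdsWithin_iff.2 ⟨hd.continuousAt.tendsto.mono_left nhdsWithin_le_nhds, h2⟩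
    exact h3.eventually h1
  set μ : Measure ℝ := volume.restrict (Ioo 0 (2 * π)) with hμ
  set F : ℕ → ℝ → ℝ := fun n θ => G (circleMap 0 (r n) θ) with hF
  set f : ℝ → ℝ := fun θ => G (circleMap 0 1 θ) with hf
  have hFint : ∀ n, Integrable (F n) μ := fun n =>
    integrableOn_comp_circleMap_of_harmonicAt hG (hr₀ n) (hr₁ n)
  have hF₀ : ∀ n, 0 ≤ᵐ[μ] F n := fun n => Eventually.of_forall fun θ => by
    have : ‖circleMap 0 (r n) θ‖ < 1 := by
      rw [norm_circleMap_zero, abs_of_pos (hr₀ n)]; exact hr₁ n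
    exact hG₀ _ this.le (lt_ne _ this)
  have hpois : ∀ n w, ‖w‖ < 1 →
      ∫ θ, poissonKernel 0 w (circleMap 0 1 θ) * F n θ ∂μ = 2 * π * G (r n * w) := fun n w hw =>
    integral_poissonKernel_mul_radial hG (hr₀ n) (hr₁ n) hw
  -- At w = 0 the kernel is 1, so all the F n have the same total mass.
  have hFA : ∀ n, ∫ θ, F n θ ∂μ = 2 * π * G 0 := fun n => by
    have := hpois n 0 (by simp)
    simpa only [poissonKernel_zero_zero_circleMap, one_mul, mul_zero] using this
  have hlim : ∀ᵐ θ ∂μ, Tendsto (fun n => F n θ) atTop (𝓝 (f θ)) := by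
    rw [hμ, ae_restrict_iff' measurableSet_Ioo]
    filter_upwards [hae] with θ hθ hθm
    have h1 : ContinuousAt G (circleMap 0 1 θ) :=
      continuousAt_const.sub ((hHc θ hθm).continuousAt.norm.log (norm_ne_zero_iff.2 (hθ hθm)))
    have h2 : Tendsto (fun n => circleMap 0 (r n) θ) atTop (𝓝 (circleMap 0 1 θ)) := by
      have := ((Complex.continuous_ofReal.tendsto 1).comp hr).mul_const (Complex.exp (θ * Complex.I))
      simpa [circleMap] using this
    exact h1.tendsto.comp h2
  obtain ⟨hfint, hf₀, hfA⟩ := integrable_and_integral_le_of_tendsto_of_nonneg hlim hFint hF₀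
    (fun n => (hFA n).le)
  have hlog : Integrable (fun θ => Real.log ‖H (circleMap 0 1 θ)‖) μ := by
    refine ((integrable_const C).sub hfint).congr (Eventually.of_forall fun θ => ?_)
    simp [hf, hGdef]
  have hPc := fun w (hw : ‖w‖ < 1) => continuous_poissonKernel_circleMap hw
  have hPint : ∀ w, ‖w‖ < 1 → ∀ u : ℝ → ℝ, Integrable u μ →
      Integrable (fun θ => poissonKernel 0 w (circleMap 0 1 θ) * u θ) μ := by
    intro w hw u hu
    obtain ⟨M, hM⟩ := (isCompact_Icc (a := 0) (b := 2 * π)).exists_bound_of_continuousOn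
      (hPc w hw).continuousOn
    refine hu.bdd_mul (c := M) (hPc w hw).aestronglyMeasurable ?_
    rw [hμ, ae_restrict_iff' measurableSet_Ioo]
    exact Eventually.of_forall fun θ hθ => hM θ (Ioo_subset_Icc_self hθ)
  -- Subtracting the value of the kernel at 1 gives a weight vanishing at both ends of the interval,
  -- which represent the point 1. Mass escaping there is lost in the limit, and away from it
  -- convergence is dominated.
  have hkey : ∀ w, ‖w‖ < 1 → 2 * π * G w - poissonKernel 0 w 1 * (2 * π * G 0) =
      ∫ θ, (poissonKernel 0 w (circleMap 0 1 θ) - poissonKernel 0 w 1) * f θ ∂μ := by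
    intro w hw
    set p : ℝ → ℝ := fun θ => poissonKernel 0 w (circleMap 0 1 θ) - poissonKernel 0 w 1 with hp
    have hpc : Continuous p := (hPc w hw).sub continuous_const
    obtain ⟨M, hM⟩ := (isCompact_Icc (a := 0) (b := 2 * π)).exists_bound_of_continuousOn
      hpc.continuousOn
    have hpM : ∀ᵐ θ ∂μ, |p θ| ≤ M := by
      rw [hμ, ae_restrict_iff' measurableSet_Ioo]
      exact Eventually.of_forall fun θ hθ => hM θ (Ioo_subset_Icc_self hθ)
    have hp0 : p 0 = 0 := by simp [hp, circleMap]
    have hp2 : p (2 * π) = 0 := by simp [hp, circleMap]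
    have hT : Tendsto (fun n => ∫ θ, p θ * F n θ ∂μ) atTop (𝓝 (∫ θ, p θ * f θ ∂μ)) := by
      refine tendsto_integral_mul_of_small_off hpc.aestronglyMeasurable hpM hFint hF₀
        (fun n => (hFA n).le) hfint hf₀ hfA fun ε hε => ?_
      have e0 : ∀ᶠ θ in 𝓝 0, |p θ| < ε :=
        hpc.continuousAt.abs.eventually_lt continuousAt_const (by simpa [hp0] using hε)
      have e2 : ∀ᶠ θ in 𝓝 (2 * π), |p θ| < ε :=
        hpc.continuousAt.abs.eventually_lt continuousAt_const (by simpa [hp2] using hε)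
      obtain ⟨δ, hδ, hδ0⟩ := Metric.eventually_nhds_iff.1 e0
      obtain ⟨δ', hδ', hδ2⟩ := Metric.eventually_nhds_iff.1 e2
      have hKsub : Icc δ (2 * π - δ') ⊆ Ioo 0 (2 * π) := fun θ hθ =>
        ⟨by linarith [hθ.1], by linarith [hθ.2]⟩
      refine ⟨Icc δ (2 * π - δ'), measurableSet_Icc, ?_, ?_⟩
      · rw [hμ, ae_restrict_iff' measurableSet_Ioo]
        refine Eventually.of_forall fun θ hθ hθK => ?_
        rw [mem_Icc, not_and_or, not_le, not_le] at hθK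
        rcases hθK with h | h
        · exact (hδ0 (by rw [Real.dist_eq, sub_zero, abs_of_pos hθ.1]; exact h)).le
        · exact (hδ2 (by rw [Real.dist_eq, abs_of_neg (by linarith [hθ.2])]; linarith)).le
      · obtain ⟨B, hB, hB0, hBd⟩ := exists_dominating_log_norm_radial (H := H)
          (isCompact_Icc (a := δ) (b := 2 * π - δ')) (fun θ hθ => hHc θ (hKsub hθ))
          (fun θ _ => hnotzero θ)
        have hM0 : 0 ≤ M := (norm_nonneg _).trans (hM 0 ⟨le_rfl, by positivity⟩)
        have hcB : Integrable (fun θ => M * (|C| + B θ)) μ :=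
          ((integrable_const |C|).add hB).const_mul M
        refine tendsto_integral_filter_of_dominated_convergence (fun θ => M * (|C| + B θ))
          (Eventually.of_forall fun n =>
            (hpc.aestronglyMeasurable.mul (hFint n).1).restrict) ?_ hcB.restrict ?_
        · filter_upwards [hr'.eventually hBd] with n hn
          rw [ae_restrict_iff' measurableSet_Icc]
          filter_upwards [hpM, ae_restrict_of_ae hn] with θ h1 h2 hθ
          rw [norm_mul, Real.norm_eq_abs, Real.norm_eq_abs]
          refine mul_le_mul h1 ?_ (abs_nonneg _) hM0
          exact (abs_sub _ _).trans (add_le_add le_rfl (h2 hθ))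
        · refine ae_restrict_of_ae ?_
          filter_upwards [hlim] with θ hθ using hθ.const_mul _
    have hG0w : ContinuousAt G w := (hG w hw).1.continuousAt
    have hT' : Tendsto (fun n => 2 * π * G (r n * w) - poissonKernel 0 w 1 * (2 * π * G 0)) atTop
        (𝓝 (2 * π * G w - poissonKernel 0 w 1 * (2 * π * G 0))) := by
      refine ((Tendsto.const_mul _ (hG0w.tendsto.comp ?_)).sub_const _)
      simpa using ((Complex.continuous_ofReal.tendsto 1).comp hr).mul_const w
    refine tendsto_nhds_unique hT' (hT.congr fun n => ?_)
    rw [← hpois n w hw, ← hFA n, ← integral_const_mul, ← integral_sub (hPint w hw _ (hFint n))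
      ((hFint n).const_mul _)]
    congr 1 with θ
    simp only [hp]
    ring
  have hone : ∀ w, ‖w‖ < 1 → ∫ θ, poissonKernel 0 w (circleMap 0 1 θ) ∂μ = 2 * π :=
    fun w hw => integral_poissonKernel_circleMap hw
  -- The atom is the mass lost in the limit, nonnegative by Fatou.
  refine ⟨hlog, G 0 - (2 * π)⁻¹ * ∫ θ, f θ ∂μ, ?_, ?_⟩
  · rw [sub_nonneg, inv_mul_le_iff₀ (by positivity)]
    exact hfA
  · intro w hw
    have h1 := hkey w hw
    have h2 : ∫ θ, (poissonKernel 0 w (circleMap 0 1 θ) - poissonKernel 0 w 1) * f θ ∂μ =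
        2 * π * C - (∫ θ, poissonKernel 0 w (circleMap 0 1 θ) *
          Real.log ‖H (circleMap 0 1 θ)‖ ∂μ) - poissonKernel 0 w 1 * ∫ θ, f θ ∂μ := by
      rw [← hone w hw, ← integral_mul_const, ← integral_const_mul, ← integral_sub, ← integral_sub]
      · congr 1 with θ
        simp only [hf, hGdef]
        ring
      · exact (hPint w hw _ (integrable_const C)).sub (hPint w hw _ hlog)
      · exact hfint.const_mul _
      · exact hPint w hw _ (integrable_const C)
      · exact hPint w hw _ hlog
    rw [h2] at h1
    have hG1 : Real.log ‖H w‖ = C - G w := by simp [hGdef]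
    rw [hG1]
    have hpi : (2 * π) ≠ 0 := by positivity
    have h3 : G w = (2 * π)⁻¹ * (2 * π * G w) := by field_simp
    rw [h3, eq_add_of_sub_eq h1]
    field_simp
    ring

/-! ### The Cayley transform between half plane and disc -/

-- The numbers iω + 1 and iω - 1 have equal moduli and arguments arctan ω and π - arctan ω.
open Set Real in
theorem circleMap_pi_sub_two_arctan (ω : ℝ) :
    circleMap 0 1 (π - 2 * Real.arctan ω) =
      ((ω : ℂ) * Complex.I - 1) / ((ω : ℂ) * Complex.I + 1) := by
  set a := Real.arctan ω with ha
  have hc : Real.cos a ≠ 0 := (Real.cos_arctan_pos ω).ne'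
  have hs : Real.sin a = ω * Real.cos a := by
    rw [← Real.tan_mul_cos hc, ha, Real.tan_arctan]
  have hsq : Real.cos a ^ 2 * (1 + ω ^ 2) = 1 := by
    have := Real.sin_sq_add_cos_sq a
    rw [hs] at this
    linarith
  have hden : (ω : ℂ) * Complex.I + 1 ≠ 0 := fun h => by
    have := congrArg Complex.re h
    simp at this
  have h1 : Real.cos (π - 2 * a) = 1 - 2 * Real.cos a ^ 2 := by
    rw [Real.cos_pi_sub, Real.cos_two_mul]; ring
  have h2 : Real.sin (π - 2 * a) = 2 * ω * Real.cos a ^ 2 := by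
    rw [Real.sin_pi_sub, Real.sin_two_mul, hs]; ring
  rw [eq_div_iff hden, circleMap, zero_add, Complex.ofReal_one, one_mul, Complex.exp_mul_I,
    ← Complex.ofReal_cos, ← Complex.ofReal_sin, h1, h2]
  generalize Real.cos a = k at *
  rw [show (((1 - 2 * k ^ 2 : ℝ) : ℂ) + ((2 * ω * k ^ 2 : ℝ) : ℂ) * Complex.I) =
    ⟨1 - 2 * k ^ 2, 2 * ω * k ^ 2⟩ from
      Complex.ext (by simp [pow_two]) (by simp [pow_two])]
  apply Complex.ext
  · simp
    linear_combination (-2) * hsq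
  · simp
    ring

open Set Real in
theorem image_pi_sub_two_arctan :
    (fun ω : ℝ => π - 2 * Real.arctan ω) '' univ = Ioo 0 (2 * π) := by
  ext θ
  simp only [image_univ, mem_range]
  constructor
  · rintro ⟨ω, rfl⟩
    exact ⟨by linarith [Real.arctan_lt_pi_div_two ω], by linarith [Real.neg_pi_div_two_lt_arctan ω]⟩
  · intro hθ
    refine ⟨Real.tan ((π - θ) / 2), ?_⟩
    rw [Real.arctan_tan (by linarith [hθ.2]) (by linarith [hθ.1])]
    ring

open Set Real in
theorem hasDerivWithinAt_pi_sub_two_arctan (ω : ℝ) (s : Set ℝ) :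
    HasDerivWithinAt (fun ω : ℝ => π - 2 * Real.arctan ω) (-(2 * (1 / (1 + ω ^ 2)))) s ω :=
  (((Real.hasDerivAt_arctan ω).const_mul 2).const_sub π).hasDerivWithinAt

open Set Real in
theorem injOn_pi_sub_two_arctan : InjOn (fun ω : ℝ => π - 2 * Real.arctan ω) univ := by
  intro x _ y _ h
  apply Real.arctan_injective
  simp only at h
  linarith

theorem add_one_ne_zero_of_mem_closedRHP {s : ℂ} (hs : s ∈ closedRHP) : s + 1 ≠ 0 := fun h => by
  have h1 := congrArg Complex.re h
  have h2 : 0 ≤ s.re := hs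
  simp at h1
  linarith

theorem re_cayley (z : ℂ) : ((1 + z) / (1 - z)).re = (1 - ‖z‖ ^ 2) / ‖1 - z‖ ^ 2 := by
  rw [← Complex.normSq_eq_norm_sq, ← Complex.normSq_eq_norm_sq, Complex.div_re, ← add_div]
  congr 1
  simp [Complex.normSq_apply]
  ring

theorem cayley_cayley {s : ℂ} (hs : s + 1 ≠ 0) :
    (1 + (s - 1) / (s + 1)) / (1 - (s - 1) / (s + 1)) = s := by
  have h1 : 1 - (s - 1) / (s + 1) = 2 / (s + 1) := by field_simp; ring
  have h2 : 1 + (s - 1) / (s + 1) = 2 * s / (s + 1) := by field_simp; ring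
  rw [h1, h2]
  field_simp

theorem norm_cayley_lt_one {s : ℂ} (hs : s ∈ openRHP) : ‖(s - 1) / (s + 1)‖ < 1 := by
  have h0 : 0 < s.re := hs
  have h1 : s + 1 ≠ 0 := add_one_ne_zero_of_mem_closedRHP (le_of_lt h0)
  rw [norm_div, div_lt_one (norm_pos_iff.2 h1), ← sq_lt_sq₀ (norm_nonneg _) (norm_nonneg _),
    ← Complex.normSq_eq_norm_sq, ← Complex.normSq_eq_norm_sq, Complex.normSq_apply,
    Complex.normSq_apply]
  simp
  nlinarith

/-- Hence an atom at 1, the image of infinity, contributes a multiple of Re s in the half plane. -/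
theorem poissonKernel_cayley_one {s : ℂ} (hs : s ∈ openRHP) :
    poissonKernel 0 ((s - 1) / (s + 1)) 1 = s.re := by
  have h0 : 0 < s.re := hs
  rw [poissonKernel_def, sub_zero, sub_zero, norm_one, one_pow, ← re_cayley,
    cayley_cayley (add_one_ne_zero_of_mem_closedRHP h0.le)]

/-- The factor 2/(1 + ω²) is |dθ/dω| for θ = π - 2 arctan ω, so this is the change of variables from
the disc kernel to the half-plane kernel. It rests on |s + 1|² - |s - 1|² = 4 Re s. -/
theorem poissonKernel_cayley_imaginary {s : ℂ} (hs : s ∈ openRHP) (ω : ℝ) :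
    2 * (1 / (1 + ω ^ 2)) * poissonKernel 0 ((s - 1) / (s + 1))
      (((ω : ℂ) * Complex.I - 1) / ((ω : ℂ) * Complex.I + 1)) =
    2 * (s.re / (s.re ^ 2 + (ω - s.im) ^ 2)) := by
  have h0 : 0 < s.re := hs
  have h1 : s + 1 ≠ 0 := add_one_ne_zero_of_mem_closedRHP h0.le
  have h2 : (ω : ℂ) * Complex.I + 1 ≠ 0 := add_one_ne_zero_of_mem_closedRHP (by simp [closedRHP])
  have e1 : ((ω : ℂ) * Complex.I - 1) / ((ω : ℂ) * Complex.I + 1) - (s - 1) / (s + 1) =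
      2 * ((ω : ℂ) * Complex.I - s) / (((ω : ℂ) * Complex.I + 1) * (s + 1)) := by
    rw [div_sub_div _ _ h2 h1]
    congr 1
    ring
  have n1 : ‖(ω : ℂ) * Complex.I + 1‖ ^ 2 = 1 + ω ^ 2 := by
    rw [← Complex.normSq_eq_norm_sq, Complex.normSq_apply]; simp; ring
  have n2 : ‖(ω : ℂ) * Complex.I - 1‖ ^ 2 = 1 + ω ^ 2 := by
    rw [← Complex.normSq_eq_norm_sq, Complex.normSq_apply]; simp; ring
  have n3 : ‖(ω : ℂ) * Complex.I - s‖ ^ 2 = s.re ^ 2 + (ω - s.im) ^ 2 := by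
    rw [← Complex.normSq_eq_norm_sq, Complex.normSq_apply]; simp; ring
  have n4 : ‖s - 1‖ ^ 2 = ‖s + 1‖ ^ 2 - 4 * s.re := by
    rw [← Complex.normSq_eq_norm_sq, ← Complex.normSq_eq_norm_sq, Complex.normSq_apply,
      Complex.normSq_apply]
    simp; ring
  have p1 : 0 < ‖s + 1‖ ^ 2 := by positivity
  have p2 : 0 < 1 + ω ^ 2 := by positivity
  have p3 : 0 < s.re ^ 2 + (ω - s.im) ^ 2 := by positivity
  simp only [poissonKernel_def, sub_zero, e1, norm_div, norm_mul, div_pow, mul_pow, n1, n2, n3, n4]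
  rw [div_self p2.ne']
  simp only [Complex.norm_ofNat]
  field_simp
  ring

/-! ### Poisson formula in the half plane for zero-free functions -/

open Set Real in
/-- The Poisson formula in the right half plane for the logarithm of the modulus of a bounded
zero-free function that is analytic up to the imaginary axis and does not decay exponentially along
the positive real axis. -/
theorem integrable_and_integral_log_norm_mul_poisson {h : ℂ → ℂ} {C : ℝ}
    (hh : ∀ s ∈ closedRHP, AnalyticAt ℂ h s) (hne : ∀ s ∈ openRHP, h s ≠ 0)
    (hb : ∀ s ∈ closedRHP, Real.log ‖h s‖ ≤ C)
    (hlim : ∀ ε > 0, ∀ᶠ x : ℝ in atTop, -(ε * x) ≤ Real.log ‖h x‖) {s : ℂ} (hs : s ∈ openRHP) :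
    Integrable (fun ω : ℝ => Real.log ‖h ((ω : ℂ) * Complex.I)‖ *
      (s.re / (s.re ^ 2 + (ω - s.im) ^ 2))) ∧
    ∫ ω : ℝ, Real.log ‖h ((ω : ℂ) * Complex.I)‖ * (s.re / (s.re ^ 2 + (ω - s.im) ^ 2)) =
      π * Real.log ‖h s‖ := by
  set H : ℂ → ℂ := fun z => h ((1 + z) / (1 - z)) with hH
  have hHs : ∀ s : ℂ, s + 1 ≠ 0 → H ((s - 1) / (s + 1)) = h s := fun s hs => by
    simp only [hH, cayley_cayley hs]
  have hmem : ∀ z : ℂ, ‖z‖ ≤ 1 → (1 + z) / (1 - z) ∈ closedRHP := fun z hz => by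
    change 0 ≤ ((1 + z) / (1 - z)).re
    rw [re_cayley]
    have : ‖z‖ ^ 2 ≤ 1 := pow_le_one₀ (norm_nonneg _) hz
    exact div_nonneg (by linarith) (by positivity)
  have hana : ∀ z : ℂ, ‖z‖ ≤ 1 → z ≠ 1 → AnalyticAt ℂ H z := fun z hz hz1 => by
    refine AnalyticAt.fun_comp (hh _ (hmem z hz)) ?_
    exact (by fun_prop : AnalyticAt ℂ (fun z : ℂ => 1 + z) z).div (by fun_prop)
      (sub_ne_zero.2 hz1.symm)
  have hHne : ∀ z : ℂ, ‖z‖ < 1 → H z ≠ 0 := fun z hz => by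
    refine hne _ ?_
    change 0 < ((1 + z) / (1 - z)).re
    rw [re_cayley]
    have h1 : ‖z‖ ^ 2 < 1 := pow_lt_one₀ (norm_nonneg _) hz two_ne_zero
    have h2 : 1 - z ≠ 0 := sub_ne_zero.2 fun h => by simp [← h] at hz
    exact div_pos (by linarith) (by positivity)
  obtain ⟨hint, c, hc, hrep⟩ := log_norm_eq_poisson_integral_sub_point_mass hana hHne
    (fun z hz _ => hb _ (hmem z hz))
  have hPint : ∀ w : ℂ, ‖w‖ < 1 → IntegrableOn (fun θ => poissonKernel 0 w (circleMap 0 1 θ) *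
      Real.log ‖H (circleMap 0 1 θ)‖) (Ioo 0 (2 * π)) := by
    intro w hw
    obtain ⟨M, hM⟩ := (isCompact_Icc (a := 0) (b := 2 * π)).exists_bound_of_continuousOn
      (continuous_poissonKernel_circleMap hw).continuousOn
    refine Integrable.bdd_mul (c := M) hint
      (continuous_poissonKernel_circleMap hw).aestronglyMeasurable ?_
    rw [ae_restrict_iff' measurableSet_Ioo]
    exact Eventually.of_forall fun θ hθ => hM θ (Ioo_subset_Icc_self hθ)
  have hrep' : ∀ s ∈ openRHP, Real.log ‖h s‖ = (2 * π)⁻¹ * (∫ θ in Ioo 0 (2 * π),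
      poissonKernel 0 ((s - 1) / (s + 1)) (circleMap 0 1 θ) *
        Real.log ‖H (circleMap 0 1 θ)‖) - c * s.re := by
    intro s hs
    rw [← poissonKernel_cayley_one hs, ← hrep _ (norm_cayley_lt_one hs),
      hHs s (add_one_ne_zero_of_mem_closedRHP (le_of_lt (show 0 < s.re from hs)))]
  -- The Poisson integral of boundary values at most C is at most C, because the kernel has mean 1.
  have hle : ∀ s ∈ openRHP, Real.log ‖h s‖ ≤ C - c * s.re := by
    intro s hs
    have hw := norm_cayley_lt_one hs
    rw [hrep' s hs]
    refine sub_le_sub_right ?_ _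
    rw [inv_mul_le_iff₀ (by positivity)]
    refine le_of_le_of_eq ?_ (congrArg (· * C) (integral_poissonKernel_circleMap hw))
    rw [← integral_mul_const]
    refine integral_mono_ae (hPint _ hw) ?_ ?_
    · exact (((continuous_poissonKernel_circleMap hw).mul continuous_const).integrableOn_Icc
        (a := 0) (b := 2 * π)).mono_set Ioo_subset_Icc_self
    · refine Eventually.of_forall fun θ => ?_
      exact mul_le_mul_of_nonneg_left (hb _ (hmem _ (by simp)))
        (poissonKernel_circleMap_nonneg hw θ)
  -- If c > 0, then -(c/2)x ≤ log‖h x‖ ≤ C - cx fails once x > 2C/c.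
  have hc0 : c = 0 := by
    by_contra hne0
    have hcpos : 0 < c := lt_of_le_of_ne hc (Ne.symm hne0)
    obtain ⟨x, h1, h2, h3⟩ := ((hlim (c / 2) (by positivity)).and
      ((eventually_gt_atTop 0).and (eventually_gt_atTop (2 * C / c)))).exists
    have h4 := hle x (show 0 < (x : ℂ).re by simpa using h2)
    rw [div_lt_iff₀ hcpos] at h3
    simp only [Complex.ofReal_re] at h4
    linarith
  have hchange : ∀ ω : ℝ, |-(2 * (1 / (1 + ω ^ 2)))| •
      (poissonKernel 0 ((s - 1) / (s + 1)) (circleMap 0 1 (π - 2 * Real.arctan ω)) *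
        Real.log ‖H (circleMap 0 1 (π - 2 * Real.arctan ω))‖) =
      2 * (Real.log ‖h ((ω : ℂ) * Complex.I)‖ * (s.re / (s.re ^ 2 + (ω - s.im) ^ 2))) := by
    intro ω
    rw [abs_neg, abs_of_nonneg (by positivity), smul_eq_mul, circleMap_pi_sub_two_arctan,
      hHs _ (add_one_ne_zero_of_mem_closedRHP (by simp [closedRHP])), ← mul_assoc,
      poissonKernel_cayley_imaginary hs]
    ring
  have hI := hPint _ (norm_cayley_lt_one hs)
  rw [← image_pi_sub_two_arctan, integrableOn_image_iff_integrableOn_abs_deriv_smul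
    MeasurableSet.univ (fun ω _ => hasDerivWithinAt_pi_sub_two_arctan ω univ)
    injOn_pi_sub_two_arctan, integrableOn_univ] at hI
  simp only [hchange] at hI
  have hE := hrep' s hs
  rw [hc0, zero_mul, sub_zero, ← image_pi_sub_two_arctan, integral_image_eq_integral_abs_deriv_smul
    MeasurableSet.univ (fun ω _ => hasDerivWithinAt_pi_sub_two_arctan ω univ)
    injOn_pi_sub_two_arctan, setIntegral_univ] at hE
  simp only [hchange] at hE
  rw [integral_const_mul] at hE
  refine ⟨by simpa using hI.const_mul (1 / 2), ?_⟩
  generalize (∫ ω : ℝ, Real.log ‖h ((ω : ℂ) * Complex.I)‖ *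
    (s.re / (s.re ^ 2 + (ω - s.im) ^ 2))) = J at hE ⊢
  rw [hE]
  have := Real.pi_ne_zero
  field_simp

/-! ### Blaschke factors and their behaviour at infinity -/

open Topology in
theorem tendsto_sub_div_add_cobounded (a b : ℂ) :
    Tendsto (fun s : ℂ => (s - a) / (s + b)) (Bornology.cobounded ℂ) (𝓝 1) := by
  have h1 : Tendsto (fun s : ℂ => s + b) (Bornology.cobounded ℂ) (Bornology.cobounded ℂ) :=
    tendsto_add_const_cobounded b
  have h2 : Tendsto (fun s : ℂ => 1 - (a + b) * (s + b)⁻¹) (Bornology.cobounded ℂ) (𝓝 1) := by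
    simpa using ((tendsto_inv₀_cobounded.comp h1).const_mul (a + b)).const_sub 1
  refine h2.congr' ?_
  filter_upwards [h1.eventually (Bornology.eventually_ne_cobounded 0)] with s hs
  field_simp
  ring

/-- The elementary inner factor of the right half plane with zero `a`. -/
noncomputable def blaschkeFactor (a s : ℂ) : ℂ := (s - a) / (s + starRingEnd ℂ a)

theorem add_conj_ne_zero {a s : ℂ} (ha : a ∈ openRHP) (hs : s ∈ closedRHP) :
    s + starRingEnd ℂ a ≠ 0 := fun h => by
  have h1 := congrArg Complex.re h
  have h2 : 0 ≤ s.re := hs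
  have h3 : 0 < a.re := ha
  simp at h1
  linarith

theorem openRHP_subset_closedRHP : openRHP ⊆ closedRHP := fun _ h => le_of_lt (Set.mem_ofPred.1 h)

theorem ofReal_mul_I_mem_closedRHP (ω : ℝ) : (ω : ℂ) * Complex.I ∈ closedRHP := by
  simp [closedRHP]

theorem analyticAt_blaschkeFactor {a s : ℂ} (ha : a ∈ openRHP) (hs : s ∈ closedRHP) :
    AnalyticAt ℂ (blaschkeFactor a) s :=
  AnalyticAt.div (by fun_prop) (by fun_prop) (add_conj_ne_zero ha hs)

theorem blaschkeFactor_ne_zero {a s : ℂ} (ha : a ∈ openRHP) (hs : s ∈ closedRHP) (hne : s ≠ a) :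
    blaschkeFactor a s ≠ 0 :=
  div_ne_zero (sub_ne_zero.2 hne) (add_conj_ne_zero ha hs)

/-- A point of the axis is equidistant from a and its mirror image -conj a, so Blaschke factors do
not change log‖f‖ on the axis. -/
theorem norm_blaschkeFactor_imaginary {a : ℂ} (ha : a ∈ openRHP) (ω : ℝ) :
    ‖blaschkeFactor a ((ω : ℂ) * Complex.I)‖ = 1 := by
  have h := add_conj_ne_zero ha (ofReal_mul_I_mem_closedRHP ω)
  rw [blaschkeFactor, norm_div, div_eq_one_iff_eq (norm_ne_zero_iff.2 h),
    ← sq_eq_sq₀ (norm_nonneg _) (norm_nonneg _), ← Complex.normSq_eq_norm_sq,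
    ← Complex.normSq_eq_norm_sq, Complex.normSq_apply, Complex.normSq_apply]
  simp
  ring

theorem meromorphicOrderAt_blaschkeFactor {a s : ℂ} (ha : a ∈ openRHP) (hs : s ∈ closedRHP) :
    meromorphicOrderAt (blaschkeFactor a) s = ((if a = s then 1 else 0 : ℤ) : WithTop ℤ) := by
  split_ifs with h
  · subst h
    rw [meromorphicOrderAt_eq_int_iff (analyticAt_blaschkeFactor ha hs).meromorphicAt]
    refine ⟨fun z => (z + starRingEnd ℂ a)⁻¹, AnalyticAt.inv (by fun_prop) (add_conj_ne_zero ha hs),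
      inv_ne_zero (add_conj_ne_zero ha hs), Eventually.of_forall fun z => ?_⟩
    simp [blaschkeFactor, div_eq_mul_inv]
  · exact ((analyticAt_blaschkeFactor ha hs).meromorphicNFAt.meromorphicOrderAt_eq_zero_iff).2
      (blaschkeFactor_ne_zero ha hs (Ne.symm h))

theorem analyticAt_prod_blaschkeFactor {m : ℕ} {a : Fin m → ℂ} (ha : ∀ i, a i ∈ openRHP) {s : ℂ}
    (hs : s ∈ closedRHP) : AnalyticAt ℂ (fun z => ∏ i, blaschkeFactor (a i) z) s :=
  Finset.analyticAt_fun_prod _ fun i _ => analyticAt_blaschkeFactor (ha i) hs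

theorem meromorphicOrderAt_prod_blaschkeFactor {m : ℕ} {a : Fin m → ℂ} (ha : ∀ i, a i ∈ openRHP)
    {s : ℂ} (hs : s ∈ closedRHP) :
    meromorphicOrderAt (fun z => ∏ i, blaschkeFactor (a i) z) s =
      ((Nat.card {i // a i = s} : ℤ) : WithTop ℤ) := by
  classical
  rw [meromorphicOrderAt_fun_prod fun i _ => (analyticAt_blaschkeFactor (ha i) hs).meromorphicAt]
  simp only [meromorphicOrderAt_blaschkeFactor (ha _) hs]
  rw [Nat.card_eq_fintype_card, Fintype.card_subtype, Finset.card_filter]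
  push_cast
  rfl

open Topology in
theorem tendsto_prod_blaschkeFactor_cobounded {m : ℕ} (a : Fin m → ℂ) :
    Tendsto (fun s : ℂ => ∏ i, blaschkeFactor (a i) s) (Bornology.cobounded ℂ) (𝓝 1) := by
  simpa using tendsto_finsetProd (f := fun i s => blaschkeFactor (a i) s) Finset.univ
    fun i _ => tendsto_sub_div_add_cobounded (a i) (starRingEnd ℂ (a i))

open Topology in
theorem tendsto_ofReal_cobounded : Tendsto (fun x : ℝ => (x : ℂ)) atTop (Bornology.cobounded ℂ) := by
  rw [← tendsto_norm_atTop_iff_cobounded]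
  simpa using tendsto_abs_atTop_atTop

open Topology in
/-- A function tending to `1` at infinity has logarithm tending to `0` along the real axis. -/
theorem tendsto_log_norm_of_tendsto_one {u : ℂ → ℂ} (hu : Tendsto u (Bornology.cobounded ℂ) (𝓝 1)) :
    Tendsto (fun x : ℝ => Real.log ‖u x‖) atTop (𝓝 0) := by
  have h1 := (hu.comp tendsto_ofReal_cobounded).norm
  rw [norm_one] at h1
  simpa using h1.log one_ne_zero

/-! ### The factor for boundary poles and polynomial growth -/

/-- The normalising factor with zeros `p` on the imaginary axis and decay of order `n`. -/
noncomputable def boundaryFactor (P : Finset ℂ) (m : ℂ → ℕ) (n : ℕ) (s : ℂ) : ℂ :=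
  (∏ p ∈ P, ((s - p) / (s + 1)) ^ m p) * ((s + 1)⁻¹) ^ n

theorem analyticAt_sub_div_add_one {s : ℂ} (hs : s ∈ closedRHP) (p : ℂ) :
    AnalyticAt ℂ (fun z : ℂ => (z - p) / (z + 1)) s :=
  AnalyticAt.fun_div (by fun_prop) (by fun_prop) (add_one_ne_zero_of_mem_closedRHP hs)

theorem analyticAt_inv_add_one {s : ℂ} (hs : s ∈ closedRHP) :
    AnalyticAt ℂ (fun z : ℂ => (z + 1)⁻¹) s :=
  AnalyticAt.fun_inv (by fun_prop) (add_one_ne_zero_of_mem_closedRHP hs)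

theorem analyticAt_boundaryFactor {P : Finset ℂ} {m : ℂ → ℕ} {n : ℕ} {s : ℂ} (hs : s ∈ closedRHP) :
    AnalyticAt ℂ (boundaryFactor P m n) s := by
  refine AnalyticAt.mul (Finset.analyticAt_fun_prod _ fun p _ => ?_) ?_
  · exact (analyticAt_sub_div_add_one hs _).fun_pow _
  · exact (analyticAt_inv_add_one hs).fun_pow _

theorem boundaryFactor_ne_zero {P : Finset ℂ} {m : ℂ → ℕ} {n : ℕ} {s : ℂ} (hs : s ∈ closedRHP)
    (hsP : s ∉ P) : boundaryFactor P m n s ≠ 0 := by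
  have h := add_one_ne_zero_of_mem_closedRHP hs
  refine mul_ne_zero (Finset.prod_ne_zero_iff.2 fun p hp => pow_ne_zero _ (div_ne_zero ?_ h))
    (pow_ne_zero _ (inv_ne_zero h))
  exact sub_ne_zero.2 fun h => hsP (h ▸ hp)

/-- The remaining factors are analytic at p and can only raise the order. A lower bound suffices to
cancel a pole of order m p, since h may vanish on the axis. -/
theorem le_meromorphicOrderAt_boundaryFactor {P : Finset ℂ} {m : ℂ → ℕ} {n : ℕ} {p : ℂ}
    (hp : p ∈ P) (hs : p ∈ closedRHP) :
    ((m p : ℤ) : WithTop ℤ) ≤ meromorphicOrderAt (boundaryFactor P m n) p := by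
  classical
  set u : ℂ → ℂ := fun s => (∏ q ∈ P.erase p, ((s - q) / (s + 1)) ^ m q) *
    ((s + 1)⁻¹ ^ m p * (s + 1)⁻¹ ^ n) with hu
  have hua : AnalyticAt ℂ u p := by
    refine AnalyticAt.mul (Finset.analyticAt_fun_prod _ fun p _ => ?_) (AnalyticAt.mul ?_ ?_)
    · exact (analyticAt_sub_div_add_one hs _).fun_pow _
    · exact (analyticAt_inv_add_one hs).fun_pow _
    · exact (analyticAt_inv_add_one hs).fun_pow _
  have heq : boundaryFactor P m n = (fun s => (s - p) ^ m p) * u := by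
    ext s
    rw [boundaryFactor, ← Finset.mul_prod_erase _ _ hp]
    simp only [Pi.mul_apply, hu, div_eq_mul_inv, mul_pow]
    ring
  rw [heq, meromorphicOrderAt_mul (by fun_prop) hua.meromorphicAt]
  have h1 : meromorphicOrderAt (fun s : ℂ => (s - p) ^ m p) p = ((m p : ℤ) : WithTop ℤ) :=
    meromorphicOrderAt_pow_id_sub_const (x := p) (n := m p)
  rw [h1]
  exact le_add_of_nonneg_right hua.meromorphicOrderAt_nonneg

open Topology in
theorem tendsto_prod_boundary_cobounded (P : Finset ℂ) (m : ℂ → ℕ) :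
    Tendsto (fun s : ℂ => ∏ p ∈ P, ((s - p) / (s + 1)) ^ m p) (Bornology.cobounded ℂ) (𝓝 1) := by
  simpa using tendsto_finsetProd (f := fun p s => ((s - p) / (s + 1)) ^ m p) P
    fun p _ => (tendsto_sub_div_add_cobounded p 1).pow (m p)

theorem norm_le_norm_add_one {s : ℂ} (hs : s ∈ closedRHP) : ‖s‖ ≤ ‖s + 1‖ := by
  have h : 0 ≤ s.re := hs
  rw [← sq_le_sq₀ (norm_nonneg _) (norm_nonneg _), ← Complex.normSq_eq_norm_sq,
    ← Complex.normSq_eq_norm_sq, Complex.normSq_apply, Complex.normSq_apply]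
  simp
  nlinarith

theorem one_le_norm_add_one {s : ℂ} (hs : s ∈ closedRHP) : 1 ≤ ‖s + 1‖ := by
  have h : 0 ≤ s.re := hs
  have := Complex.re_le_norm (s + 1)
  simp at this
  linarith

theorem eventually_le_log_norm_boundaryFactor (P : Finset ℂ) (m : ℂ → ℕ) (n : ℕ) {ε : ℝ}
    (hε : 0 < ε) : ∀ᶠ x : ℝ in atTop, -(ε * x) ≤ Real.log ‖boundaryFactor P m n x‖ := by
  have h1 := tendsto_log_norm_of_tendsto_one (tendsto_prod_boundary_cobounded P m)
  have hne : ∀ᶠ s in Bornology.cobounded ℂ, (∏ p ∈ P, ((s - p) / (s + 1)) ^ m p) ≠ 0 :=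
    (tendsto_prod_boundary_cobounded P m).eventually_ne one_ne_zero
  have h2 : Tendsto (fun x : ℝ => n * (Real.log (x + 1) / (x + 1))) atTop (nhds 0) := by
    have h3 : Tendsto (fun x : ℝ => Real.log x / x) atTop (nhds 0) :=
      Real.isLittleO_log_id_atTop.tendsto_div_nhds_zero
    simpa using (h3.comp (tendsto_atTop_add_const_right atTop (1 : ℝ) tendsto_id)).const_mul (n : ℝ)
  -- The product contributes more than -1 > -εx/2 as x > 2/ε, and n log(x + 1) < ε(x + 1)/4 < εx/2
  -- as x > 1.
  filter_upwards [h1.eventually (eventually_gt_nhds (show -1 < (0 : ℝ) by norm_num)),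
    h2.eventually (eventually_lt_nhds (show (0 : ℝ) < ε / 4 by positivity)),
    tendsto_ofReal_cobounded.eventually hne, eventually_gt_atTop 1,
    eventually_gt_atTop (2 / ε)] with x e1 e2 e3 e4 e5
  have hx : ‖(x : ℂ) + 1‖ = x + 1 := by
    rw [show (x : ℂ) + 1 = ((x + 1 : ℝ) : ℂ) by push_cast; ring, Complex.norm_real,
      Real.norm_eq_abs, abs_of_pos (by linarith)]
  rw [boundaryFactor, norm_mul, norm_pow, norm_inv, hx, Real.log_mul (norm_ne_zero_iff.2 e3)
    (pow_ne_zero _ (inv_ne_zero (by linarith))), Real.log_pow, Real.log_inv]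
  rw [← mul_div_assoc, div_lt_iff₀ (by linarith)] at e2
  rw [div_lt_iff₀ hε] at e5
  nlinarith

open Topology in
/-- A continuous function on the closed right half plane that is bounded near infinity has
logarithm bounded above. -/
theorem exists_log_norm_le_of_eventually {u : ℂ → ℂ} (hu : ContinuousOn u closedRHP) {M : ℝ}
    (hM : ∀ᶠ s in Bornology.cobounded ℂ, s ∈ closedRHP → ‖u s‖ ≤ M) :
    ∃ C, ∀ s ∈ closedRHP, Real.log ‖u s‖ ≤ C := by
  obtain ⟨R, -, hR⟩ := (Metric.hasBasis_cobounded_compl_closedBall (0 : ℂ)).eventually_iff.1 hM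
  have hclosed : IsClosed closedRHP := isClosed_le continuous_const Complex.continuous_re
  have hcomp : IsCompact (Metric.closedBall (0 : ℂ) R ∩ closedRHP) :=
    (isCompact_closedBall 0 R).inter_right hclosed
  obtain ⟨M', hM'⟩ := hcomp.exists_bound_of_continuousOn (hu.mono Set.inter_subset_right)
  -- The maximum with 1 keeps the bound nonnegative, as needed at zeros of u, where `Real.log 0 =
  -- 0`.
  refine ⟨Real.log (max (max M M') 1), fun s hs => ?_⟩
  have hle : ‖u s‖ ≤ max (max M M') 1 := by
    by_cases h : s ∈ Metric.closedBall (0 : ℂ) R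
    · exact (hM' s ⟨h, hs⟩).trans ((le_max_right _ _).trans (le_max_left _ _))
    · exact (hR h hs).trans ((le_max_left _ _).trans (le_max_left _ _))
  rcases eq_or_ne ‖u s‖ 0 with h | h
  · rw [h, Real.log_zero]
    exact Real.log_nonneg (le_max_right _ _)
  · exact Real.log_le_log (lt_of_le_of_ne (norm_nonneg _) (Ne.symm h)) hle

/-! ### Meromorphic orders and lists of zeros and poles -/

theorem toMeromorphicNFOn_apply_of_analyticAt {u : ℂ → ℂ} {U : Set ℂ} (hu : MeromorphicOn u U)
    {s : ℂ} (hs : s ∈ U) (hus : AnalyticAt ℂ u s) : toMeromorphicNFOn u U s = u s := by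
  rw [toMeromorphicNFOn_eq_toMeromorphicNFAt hu hs, toMeromorphicNFAt_eq_self.2 hus.meromorphicNFAt]

/-- The poles in a compact set are finite in number. -/
theorem finite_setOf_meromorphicOrderAt_neg {f : ℂ → ℂ} {K : Set ℂ} (hK : IsCompact K)
    (hf : MeromorphicOn f K) : {s ∈ K | meromorphicOrderAt f s < 0}.Finite := by
  refine ((MeromorphicOn.divisor f K).finiteSupport hK).subset ?_
  rintro s ⟨hsK, hs⟩
  rw [Function.mem_support, MeromorphicOn.divisor_apply hf hsK]
  simp only [ne_eq, WithTop.untop₀_eq_zero, not_or]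
  exact ⟨hs.ne, hs.ne_top⟩

theorem ListsZeros.meromorphicOrderAt_ne_top {f : ℂ → ℂ} {m : ℕ} {a : Fin m → ℂ}
    (h : ListsZeros f a) {s : ℂ} (hs : s ∈ openRHP) : meromorphicOrderAt f s ≠ ⊤ := fun ht => by
  have h1 := h.2 s hs
  rw [ht, max_eq_left le_top] at h1
  exact WithTop.coe_ne_top h1.symm

/-- The order is its positive part minus its negative part; β counts the former, α the latter. -/
theorem meromorphicOrderAt_eq_card_sub_card {f : ℂ → ℂ} {M N : ℕ} {α : Fin M → ℂ} {β : Fin N → ℂ}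
    (hβ : ListsZeros f β) (hα : ListsZeros f⁻¹ α) {s : ℂ} (hs : s ∈ openRHP) :
    meromorphicOrderAt f s =
      (((Nat.card {i // β i = s} : ℤ) - (Nat.card {i // α i = s} : ℤ) : ℤ) : WithTop ℤ) := by
  have h1 := hβ.2 s hs
  have h2 := hα.2 s hs
  rw [meromorphicOrderAt_inv] at h2
  lift meromorphicOrderAt f s to ℤ using hβ.meromorphicOrderAt_ne_top hs with k
  have h1' : max k 0 = (Nat.card {i // β i = s} : ℤ) := by exact_mod_cast h1
  have h2' : max (-k) 0 = (Nat.card {i // α i = s} : ℤ) := by exact_mod_cast h2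
  rw [← h1', ← h2']
  congr 1
  omega

theorem card_fiber_eq_zero {m : ℕ} {a : Fin m → ℂ} {s : ℂ} (h : ∀ i, s ≠ a i) :
    Nat.card {i // a i = s} = 0 := by
  have : IsEmpty {i // a i = s} := ⟨fun i => h i.1 i.2.symm⟩
  exact Nat.card_of_isEmpty

/-! ### The Poisson–Jensen formula -/

open Topology in
/-- The Poisson–Jensen formula in the right half plane for a meromorphic function of polynomial
growth that does not decay exponentially along the positive real axis. -/
theorem poisson_jensen_rightHalfPlane {f : ℂ → ℂ} (hf : MeromorphicNFOn f closedRHP)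
    {n : ℕ} {C R : ℝ}
    (hbound : ∀ s ∈ closedRHP, R ≤ ‖s‖ → 0 ≤ meromorphicOrderAt f s ∧ ‖f s‖ ≤ C * ‖s‖ ^ n)
    (hgrowth : ∀ ε > 0, ∀ᶠ x : ℝ in atTop, -(ε * x) ≤ Real.log ‖f x‖)
    {M N : ℕ} {α : Fin M → ℂ} {β : Fin N → ℂ} (hβ : ListsZeros f β) (hα : ListsZeros f⁻¹ α)
    {s₀ : ℂ} (hs₀ : s₀ ∈ openRHP) (hs₀α : ∀ i, s₀ ≠ α i) (hs₀β : ∀ i, s₀ ≠ β i) :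
    Integrable (fun ω : ℝ => Real.log ‖f ((ω : ℂ) * Complex.I)‖ *
      (s₀.re / (s₀.re ^ 2 + (ω - s₀.im) ^ 2))) ∧
    ∫ ω : ℝ, Real.log ‖f ((ω : ℂ) * Complex.I)‖ * (s₀.re / (s₀.re ^ 2 + (ω - s₀.im) ^ 2)) =
      Real.pi * (Real.log ‖f s₀‖ + ∑ i, Real.log ‖blaschkeFactor (α i) s₀‖ -
        ∑ i, Real.log ‖blaschkeFactor (β i) s₀‖) := by
  classical
  have hsub := openRHP_subset_closedRHP
  have hmf : MeromorphicOn f closedRHP := hf.meromorphicOn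
  have hconv : Convex ℝ closedRHP := convex_halfSpace_re_ge 0
  have hntop : ∀ s ∈ closedRHP, meromorphicOrderAt f s ≠ ⊤ := fun s hs =>
    hmf.meromorphicOrderAt_ne_top_of_isPreconnected hconv.isPreconnected (hsub hs₀) hs
      (hβ.meromorphicOrderAt_ne_top hs₀)
  -- the poles on the imaginary axis
  have hfin : {s ∈ closedRHP | meromorphicOrderAt f s < 0}.Finite := by
    have hclosed : IsClosed closedRHP := isClosed_le continuous_const Complex.continuous_re
    refine (finite_setOf_meromorphicOrderAt_neg (f := f)
      ((isCompact_closedBall (0 : ℂ) R).inter_right hclosed)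
      (fun s hs => hmf s hs.2)).subset ?_
    rintro s ⟨hs, hs'⟩
    refine ⟨⟨?_, hs⟩, hs'⟩
    rw [mem_closedBall_zero_iff]
    by_contra! hc
    exact absurd (hbound s hs hc.le).1 (not_le.2 hs')
  set P : Finset ℂ := hfin.toFinset.filter (fun s => s.re = 0) with hP
  have hPmem : ∀ s, s ∈ P ↔ s ∈ closedRHP ∧ meromorphicOrderAt f s < 0 ∧ s.re = 0 := by
    intro s
    simp [hP, and_assoc]
  -- The order of the pole of f at s, and 0 where there is no pole.
  set m : ℂ → ℕ := fun s => (-(meromorphicOrderAt f s).untop₀).toNat with hm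
  set Q := boundaryFactor P m n with hQ
  set A : ℂ → ℂ := fun s => ∏ i, blaschkeFactor (α i) s with hA
  set B : ℂ → ℂ := fun s => ∏ i, blaschkeFactor (β i) s with hB
  -- A cancels the poles α of f, 1/B its zeros β, and Q its poles on the axis and its growth.
  set k : ℂ → ℂ := f * (A * B⁻¹ * Q) with hk
  have hAa : ∀ s ∈ closedRHP, AnalyticAt ℂ A s := fun s hs => analyticAt_prod_blaschkeFactor hα.1 hs
  have hBa : ∀ s ∈ closedRHP, AnalyticAt ℂ B s := fun s hs => analyticAt_prod_blaschkeFactor hβ.1 hs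
  have hQa : ∀ s ∈ closedRHP, AnalyticAt ℂ Q s := fun s hs => analyticAt_boundaryFactor hs
  have hAne : ∀ s ∈ closedRHP, (∀ i, s ≠ α i) → A s ≠ 0 := fun s hs h =>
    Finset.prod_ne_zero_iff.2 fun i _ => blaschkeFactor_ne_zero (hα.1 i) hs (h i)
  have hBne : ∀ s ∈ closedRHP, (∀ i, s ≠ β i) → B s ≠ 0 := fun s hs h =>
    Finset.prod_ne_zero_iff.2 fun i _ => blaschkeFactor_ne_zero (hβ.1 i) hs (h i)
  have hQne : ∀ s ∈ openRHP, Q s ≠ 0 := fun s hs =>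
    boundaryFactor_ne_zero (hsub hs) fun h => ((hPmem s).1 h).2.2.not_gt hs
  have hkm : MeromorphicOn k closedRHP := fun s hs =>
    (hmf s hs).mul (((hAa s hs).meromorphicAt.mul (hBa s hs).meromorphicAt.inv).mul
      (hQa s hs).meromorphicAt)
  have hkord : ∀ s ∈ closedRHP, meromorphicOrderAt k s = meromorphicOrderAt f s +
      ((((Nat.card {i // α i = s} : ℤ) : WithTop ℤ) + -((Nat.card {i // β i = s} : ℤ) : WithTop ℤ)) +
        meromorphicOrderAt Q s) := by
    intro s hs
    have a1 := (hAa s hs).meromorphicAt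
    have a2 := (hBa s hs).meromorphicAt.inv
    rw [hk, meromorphicOrderAt_mul (hmf s hs) ((a1.mul a2).mul (hQa s hs).meromorphicAt),
      meromorphicOrderAt_mul (a1.mul a2) (hQa s hs).meromorphicAt, meromorphicOrderAt_mul a1 a2,
      meromorphicOrderAt_inv, hA, hB, meromorphicOrderAt_prod_blaschkeFactor hα.1 hs,
      meromorphicOrderAt_prod_blaschkeFactor hβ.1 hs]
  have hkord_open : ∀ s ∈ openRHP, meromorphicOrderAt k s = 0 := by
    intro s hs
    have hQ0 : meromorphicOrderAt Q s = 0 :=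
      ((hQa s (hsub hs)).meromorphicNFAt.meromorphicOrderAt_eq_zero_iff).2 (hQne s hs)
    rw [hkord s (hsub hs), hQ0, meromorphicOrderAt_eq_card_sub_card hβ hα hs]
    generalize (Nat.card {i // α i = s} : ℤ) = a, (Nat.card {i // β i = s} : ℤ) = b
    norm_cast
    omega
  have hkord_nonneg : ∀ s ∈ closedRHP, 0 ≤ meromorphicOrderAt k s := by
    intro s hs
    rcases (show 0 ≤ s.re from hs).lt_or_eq with h | h
    · exact (hkord_open s h).ge
    · have c1 : Nat.card {i // α i = s} = 0 := card_fiber_eq_zero fun i hi => by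
        have := hα.1 i
        rw [← hi] at this
        exact (show 0 < s.re from this).ne h
      have c2 : Nat.card {i // β i = s} = 0 := card_fiber_eq_zero fun i hi => by
        have := hβ.1 i
        rw [← hi] at this
        exact (show 0 < s.re from this).ne h
      have hQ0 := (hQa s hs).meromorphicOrderAt_nonneg
      rw [hkord s hs, c1, c2]
      simp only [Nat.cast_zero, WithTop.coe_zero, neg_zero, zero_add]
      by_cases hp : meromorphicOrderAt f s < 0
      · have hsP : s ∈ P := (hPmem s).2 ⟨hs, hp, h.symm⟩
        have h1 := le_meromorphicOrderAt_boundaryFactor (m := m) (n := n) hsP hs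
        refine le_trans ?_ (add_le_add le_rfl h1)
        simp only [hm]
        lift meromorphicOrderAt f s to ℤ using hntop s hs with j
        simp only [WithTop.untop₀_coe]
        norm_cast
        omega
      · exact add_nonneg (not_lt.1 hp) hQ0
  -- The orders of k are right, but its values at removable singularities need not be; the normal
  -- form repairs them.
  set h : ℂ → ℂ := toMeromorphicNFOn k closedRHP with hh
  have hnf : MeromorphicNFOn h closedRHP := meromorphicNFOn_toMeromorphicNFOn k closedRHP
  have hha : ∀ s ∈ closedRHP, AnalyticAt ℂ h s := fun s hs => by
    rw [← (hnf hs).meromorphicOrderAt_nonneg_iff_analyticAt,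
      meromorphicOrderAt_toMeromorphicNFOn hkm hs]
    exact hkord_nonneg s hs
  have hhne : ∀ s ∈ openRHP, h s ≠ 0 := fun s hs => by
    rw [← (hnf (hsub hs)).meromorphicOrderAt_eq_zero_iff,
      meromorphicOrderAt_toMeromorphicNFOn hkm (hsub hs)]
    exact hkord_open s hs
  have hheq : ∀ s ∈ closedRHP, AnalyticAt ℂ f s → (∀ i, s ≠ β i) →
      h s = f s * (A s * (B s)⁻¹ * Q s) := fun s hs hfs hsβ =>
    toMeromorphicNFOn_apply_of_analyticAt hkm hs (hfs.mul (((hAa s hs).mul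
      ((hBa s hs).inv (hBne s hs hsβ))).mul (hQa s hs)))
  -- behaviour at infinity
  have hAlim : Tendsto A (Bornology.cobounded ℂ) (𝓝 1) := tendsto_prod_blaschkeFactor_cobounded α
  have hBlim : Tendsto B (Bornology.cobounded ℂ) (𝓝 1) := tendsto_prod_blaschkeFactor_cobounded β
  have hElim := tendsto_prod_boundary_cobounded P m
  have hlarge : ∀ᶠ s in Bornology.cobounded ℂ, R ≤ ‖s‖ :=
    tendsto_norm_cobounded_atTop.eventually_ge_atTop R
  have hβlarge : ∀ᶠ s in Bornology.cobounded ℂ, ∀ i, s ≠ β i :=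
    eventually_all.2 fun i => Bornology.eventually_ne_cobounded (β i)
  have hheq' : ∀ᶠ s in Bornology.cobounded ℂ, s ∈ closedRHP →
      h s = f s * (A s * (B s)⁻¹ * Q s) := by
    filter_upwards [hlarge, hβlarge] with s h1 h2 hs
    exact hheq s hs ((hf hs).meromorphicOrderAt_nonneg_iff_analyticAt.1 (hbound s hs h1).1) h2
  obtain ⟨Ch, hCh⟩ : ∃ C', ∀ s ∈ closedRHP, Real.log ‖h s‖ ≤ C' := by
    have hprod := (hAlim.mul (hBlim.inv₀ one_ne_zero)).mul hElim
    have hlt := hprod.norm.eventually (eventually_lt_nhds (b := 2) (by norm_num))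
    refine exists_log_norm_le_of_eventually (M := 2 * |C|)
      (fun s hs => (hha s hs).continuousAt.continuousWithinAt) ?_
    filter_upwards [hheq', hlarge, hlt] with s h1 h2 h3 hs
    have h4 := (hbound s hs h2).2
    -- In the right half plane ‖s‖ ≤ ‖s + 1‖, so the decay of Q absorbs the growth of f.
    have h5 : ‖f s‖ * ‖(s + 1)⁻¹ ^ n‖ ≤ |C| := by
      rw [norm_pow, norm_inv, inv_pow, ← div_eq_mul_inv,
        div_le_iff₀ (pow_pos (zero_lt_one.trans_le (one_le_norm_add_one hs)) n)]
      refine h4.trans (mul_le_mul (le_abs_self C)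
        (pow_le_pow_left₀ (norm_nonneg _) (norm_le_norm_add_one hs) n) (by positivity)
        (abs_nonneg C))
    rw [h1 hs, hQ, boundaryFactor, show f s * (A s * (B s)⁻¹ *
      ((∏ p ∈ P, ((s - p) / (s + 1)) ^ m p) * (s + 1)⁻¹ ^ n)) =
      (A s * (B s)⁻¹ * ∏ p ∈ P, ((s - p) / (s + 1)) ^ m p) * (f s * (s + 1)⁻¹ ^ n) by ring,
      norm_mul, norm_mul (f s)]
    exact mul_le_mul h3.le h5 (by positivity) (by norm_num)
  obtain ⟨CQ, hCQ⟩ : ∃ C', ∀ s ∈ closedRHP, Real.log ‖Q s‖ ≤ C' := by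
    have hlt := hElim.norm.eventually (eventually_lt_nhds (b := 2) (by norm_num))
    refine exists_log_norm_le_of_eventually (M := 2)
      (fun s hs => (hQa s hs).continuousAt.continuousWithinAt) ?_
    filter_upwards [hlt] with s h1 hs
    rw [hQ, boundaryFactor, norm_mul, norm_pow, norm_inv]
    exact (mul_le_of_le_one_right (norm_nonneg _) (pow_le_one₀ (by positivity)
      (inv_le_one_of_one_le₀ (one_le_norm_add_one hs)))).trans h1.le
  have hQgrowth : ∀ ε > 0, ∀ᶠ x : ℝ in atTop, -(ε * x) ≤ Real.log ‖Q x‖ := fun ε hε =>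
    eventually_le_log_norm_boundaryFactor P m n hε
  have hhgrowth : ∀ ε > 0, ∀ᶠ x : ℝ in atTop, -(ε * x) ≤ Real.log ‖h x‖ := by
    intro ε hε
    have hABlim : Tendsto (fun s => A s * (B s)⁻¹) (Bornology.cobounded ℂ) (𝓝 1) := by
      simpa using hAlim.mul (hBlim.inv₀ one_ne_zero)
    filter_upwards [hgrowth (ε / 3) (by positivity), hQgrowth (ε / 3) (by positivity),
      (tendsto_log_norm_of_tendsto_one hABlim).eventually
        (eventually_gt_nhds (show -1 < (0 : ℝ) by norm_num)),
      tendsto_ofReal_cobounded.eventually hheq', eventually_gt_atTop 0,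
      eventually_gt_atTop (3 / ε)] with x e1 e2 e3 e4 e5 e6
    have hx : (x : ℂ) ∈ openRHP := show 0 < (x : ℂ).re by simpa using e5
    have e7 := e4 (hsub hx)
    have e8 := hhne x hx
    rw [e7] at e8
    have hf0 := left_ne_zero_of_mul e8
    have hABQ := right_ne_zero_of_mul e8
    rw [div_lt_iff₀ hε] at e6
    rw [e7, norm_mul, norm_mul (A x * (B x)⁻¹), Real.log_mul (norm_ne_zero_iff.2 hf0)
      (mul_ne_zero (norm_ne_zero_iff.2 (left_ne_zero_of_mul hABQ))
        (norm_ne_zero_iff.2 (right_ne_zero_of_mul hABQ))),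
      Real.log_mul (norm_ne_zero_iff.2 (left_ne_zero_of_mul hABQ))
        (norm_ne_zero_iff.2 (right_ne_zero_of_mul hABQ))]
    linarith
  obtain ⟨ih, eh⟩ := integrable_and_integral_log_norm_mul_poisson hha hhne hCh hhgrowth hs₀
  obtain ⟨iQ, eQ⟩ := integrable_and_integral_log_norm_mul_poisson hQa hQne hCQ hQgrowth hs₀
  -- comparison on the imaginary axis
  have haxis : ∀ᵐ ω : ℝ, Real.log ‖f ((ω : ℂ) * Complex.I)‖ =
      Real.log ‖h ((ω : ℂ) * Complex.I)‖ - Real.log ‖Q ((ω : ℂ) * Complex.I)‖ := by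
    -- Zeros and poles of f on the axis are isolated, hence form a null set; elsewhere Q does not
    -- vanish either.
    have h1 : ∀ᵐ ω : ℝ, ω ∈ Set.univ → AnalyticAt ℂ f ((ω : ℂ) * Complex.I) ∧
        f ((ω : ℂ) * Complex.I) ≠ 0 := by
      refine ae_of_forall_eventually_nhdsNE fun ω _ => ?_
      have hω := ofReal_mul_I_mem_closedRHP ω
      have e1 := (hmf _ hω).eventually_analyticAt
      have e2 := (meromorphicOrderAt_ne_top_iff_eventually_ne_zero (hmf _ hω)).1 (hntop _ hω)
      have e3 : Tendsto (fun t : ℝ => (t : ℂ) * Complex.I) (𝓝[≠] ω) (𝓝[≠] ((ω : ℂ) * Complex.I)) := by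
        refine tendsto_nhdsWithin_iff.2 ⟨Tendsto.mono_left
          (Continuous.tendsto (by fun_prop) ω) nhdsWithin_le_nhds, ?_⟩
        filter_upwards [self_mem_nhdsWithin] with t ht heq
        exact ht (by simpa using heq)
      exact e3.eventually (e1.and e2)
    filter_upwards [h1] with ω hω
    obtain ⟨ha, hne⟩ := hω trivial
    have hm' := ofReal_mul_I_mem_closedRHP ω
    have hneβ : ∀ i, (ω : ℂ) * Complex.I ≠ β i := fun i hi => by
      have := hβ.1 i
      rw [← hi] at this
      simp [openRHP] at this
    have hQ0 : Q ((ω : ℂ) * Complex.I) ≠ 0 := boundaryFactor_ne_zero hm' fun hmem =>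
      absurd ((hf hm').meromorphicOrderAt_nonneg_iff_analyticAt.2 ha)
        (not_le.2 ((hPmem _).1 hmem).2.1)
    have hA1 : ‖A ((ω : ℂ) * Complex.I)‖ = 1 := by
      simp only [hA, norm_prod, norm_blaschkeFactor_imaginary (hα.1 _), Finset.prod_const_one]
    have hB1 : ‖B ((ω : ℂ) * Complex.I)‖ = 1 := by
      simp only [hB, norm_prod, norm_blaschkeFactor_imaginary (hβ.1 _), Finset.prod_const_one]
    rw [hheq _ hm' ha hneβ, norm_mul, norm_mul, norm_mul, norm_inv, hA1, hB1, inv_one, one_mul,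
      one_mul, Real.log_mul (norm_ne_zero_iff.2 hne) (norm_ne_zero_iff.2 hQ0)]
    ring
  have hcongr : (fun ω : ℝ => Real.log ‖h ((ω : ℂ) * Complex.I)‖ *
        (s₀.re / (s₀.re ^ 2 + (ω - s₀.im) ^ 2)) - Real.log ‖Q ((ω : ℂ) * Complex.I)‖ *
        (s₀.re / (s₀.re ^ 2 + (ω - s₀.im) ^ 2))) =ᵐ[volume]
      fun ω : ℝ => Real.log ‖f ((ω : ℂ) * Complex.I)‖ *
        (s₀.re / (s₀.re ^ 2 + (ω - s₀.im) ^ 2)) := by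
    filter_upwards [haxis] with ω hω
    rw [hω]
    ring
  refine ⟨(ih.sub iQ).congr hcongr, ?_⟩
  have hf0 : meromorphicOrderAt f s₀ = 0 := by
    rw [meromorphicOrderAt_eq_card_sub_card hβ hα hs₀, card_fiber_eq_zero hs₀α,
      card_fiber_eq_zero hs₀β]
    simp
  have hfa : AnalyticAt ℂ f s₀ := (hf (hsub hs₀)).meromorphicOrderAt_nonneg_iff_analyticAt.1 hf0.ge
  have hfne : f s₀ ≠ 0 := (hf (hsub hs₀)).meromorphicOrderAt_eq_zero_iff.1 hf0
  have hA0 := hAne s₀ (hsub hs₀) hs₀α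
  have hB0 := hBne s₀ (hsub hs₀) hs₀β
  have hlogA : Real.log ‖A s₀‖ = ∑ i, Real.log ‖blaschkeFactor (α i) s₀‖ := by
    simp only [hA, norm_prod]
    exact Real.log_prod fun i _ =>
      norm_ne_zero_iff.2 (blaschkeFactor_ne_zero (hα.1 i) (hsub hs₀) (hs₀α i))
  have hlogB : Real.log ‖B s₀‖ = ∑ i, Real.log ‖blaschkeFactor (β i) s₀‖ := by
    simp only [hB, norm_prod]
    exact Real.log_prod fun i _ =>
      norm_ne_zero_iff.2 (blaschkeFactor_ne_zero (hβ.1 i) (hsub hs₀) (hs₀β i))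
  rw [← integral_congr_ae hcongr, integral_sub ih iQ, eh, eQ, hheq s₀ (hsub hs₀) hfa hs₀β,
    norm_mul, norm_mul, norm_mul, norm_inv,
    Real.log_mul (norm_ne_zero_iff.2 hfne) (mul_ne_zero (mul_ne_zero (norm_ne_zero_iff.2 hA0)
      (inv_ne_zero (norm_ne_zero_iff.2 hB0))) (norm_ne_zero_iff.2 (hQne s₀ hs₀))),
    Real.log_mul (mul_ne_zero (norm_ne_zero_iff.2 hA0) (inv_ne_zero (norm_ne_zero_iff.2 hB0)))
      (norm_ne_zero_iff.2 (hQne s₀ hs₀)),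
    Real.log_mul (norm_ne_zero_iff.2 hA0) (inv_ne_zero (norm_ne_zero_iff.2 hB0)), Real.log_inv,
    hlogA, hlogB]
  ring

/-! ### The sensitivity function and the main theorem -/

theorem IsTransferFunction.meromorphicOn_one_div_one_add {G : ℂ → ℂ} (hG : IsTransferFunction G) :
    MeromorphicOn (fun s => 1 / (1 + G s)) closedRHP := fun s hs =>
  (MeromorphicAt.const 1 s).div ((MeromorphicAt.const 1 s).add (hG.1 s hs))

open Topology in
theorem sensitivity_inv_eventuallyEq {G : ℂ → ℂ} (hG : IsTransferFunction G) {s : ℂ}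
    (hs : s ∈ closedRHP) : (sensitivity G)⁻¹ =ᶠ[𝓝[≠] s] fun z => 1 + G z := by
  filter_upwards [hG.meromorphicOn_one_div_one_add.toMeromorphicNFOn_eq_self_on_nhdsNE hs] with z hz
  rw [Pi.inv_apply, sensitivity, hz]
  simp

theorem meromorphicNFOn_sensitivity (G : ℂ → ℂ) : MeromorphicNFOn (sensitivity G) closedRHP :=
  meromorphicNFOn_toMeromorphicNFOn _ _

open Topology in
theorem frequently_mem_openRHP {s : ℂ} (hs : s ∈ closedRHP) : ∃ᶠ z in 𝓝[≠] s, z ∈ openRHP := by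
  have h1 : Tendsto (fun t : ℝ => s + t) (𝓝[>] 0) (𝓝[≠] s) := by
    refine tendsto_nhdsWithin_iff.2 ⟨Tendsto.mono_left ?_ nhdsWithin_le_nhds, ?_⟩
    · have : Continuous fun t : ℝ => s + t := by fun_prop
      simpa using this.tendsto 0
    · filter_upwards [self_mem_nhdsWithin] with t ht heq
      have ht : 0 < t := ht
      have heq : s + t = s := heq
      simp [ht.ne'] at heq
  refine h1.frequently (Eventually.frequently ?_)
  filter_upwards [self_mem_nhdsWithin] with t ht
  have ht : 0 < t := ht
  have hs : 0 ≤ s.re := hs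
  change 0 < (s + t).re
  simp
  linarith

-- The bound on G is available only in the half plane, so it is used along points of the open half
-- plane tending to s. A pole at s would make the modulus tend to infinity along them; in its
-- absence the bound passes to s by continuity.
open Topology in
theorem IsTransferFunction.exists_bound_sensitivity_inv {G : ℂ → ℂ} (hG : IsTransferFunction G) :
    ∃ (n : ℕ) (C R : ℝ), ∀ s ∈ closedRHP, R ≤ ‖s‖ →
      0 ≤ meromorphicOrderAt (sensitivity G)⁻¹ s ∧ ‖(sensitivity G)⁻¹ s‖ ≤ C * ‖s‖ ^ n := by
  obtain ⟨n, C, R, hb⟩ := hG.2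
  -- The added 1 gives ‖s‖ ≥ 1, so that ‖s‖ ^ n absorbs the summand 1 of 1 + G, and keeps points
  -- near s beyond radius R.
  refine ⟨n, 1 + C, max R 0 + 1, fun s hs hR => ?_⟩
  have hnf : MeromorphicNFAt (sensitivity G)⁻¹ s := (meromorphicNFOn_sensitivity G hs).inv
  have hRs : R < ‖s‖ := by linarith [le_max_left R 0]
  have h1s : 1 ≤ ‖s‖ := by linarith [le_max_right R 0]
  have hev : ∀ᶠ z in 𝓝[≠] s, R < ‖z‖ :=
    (continuous_norm.continuousAt.eventually_const_lt hRs).filter_mono nhdsWithin_le_nhds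
  have hfreq : ∃ᶠ z in 𝓝[≠] s, ‖(sensitivity G)⁻¹ z‖ ≤ 1 + C * ‖z‖ ^ n := by
    refine ((frequently_mem_openRHP hs).and_eventually
      ((sensitivity_inv_eventuallyEq hG hs).and hev)).mono ?_
    rintro z ⟨hz, hz1, hz2⟩
    rw [hz1]
    refine (norm_add_le _ _).trans ?_
    rw [norm_one]
    exact add_le_add le_rfl (hb z (openRHP_subset_closedRHP hz) hz2.le)
  have hcont : Tendsto (fun z : ℂ => 1 + C * ‖z‖ ^ n) (𝓝[≠] s) (𝓝 (1 + C * ‖s‖ ^ n)) :=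
    Tendsto.mono_left (Continuous.tendsto (by fun_prop) s) nhdsWithin_le_nhds
  have hord : 0 ≤ meromorphicOrderAt (sensitivity G)⁻¹ s := by
    by_contra! hneg
    have h1 := tendsto_norm_atTop_iff_cobounded.2 (tendsto_cobounded_of_meromorphicOrderAt_neg hneg)
    obtain ⟨z, hz1, hz2, hz3⟩ := (hfreq.and_eventually
      ((h1.eventually_gt_atTop (1 + C * ‖s‖ ^ n + 1)).and
        (hcont.eventually (eventually_lt_nhds (lt_add_one _))))).exists
    linarith
  refine ⟨hord, ?_⟩
  have ha := hnf.meromorphicOrderAt_nonneg_iff_analyticAt.1 hord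
  have hle : ‖(sensitivity G)⁻¹ s‖ ≤ 1 + C * ‖s‖ ^ n :=
    le_of_tendsto_of_tendsto_of_frequently
      (ha.continuousAt.norm.tendsto.mono_left nhdsWithin_le_nhds) hcont hfreq
  have := one_le_pow₀ h1s (n := n)
  rw [add_mul, one_mul]
  linarith

/-- A bound c x^n on |g| bounds |1/g| from below, and log c + n log x is o(x). -/
theorem IsWellPosed.eventually_le_log_norm_sensitivity_inv {G : ℂ → ℂ} (hG : IsWellPosed G) {ε : ℝ}
    (hε : 0 < ε) : ∀ᶠ x : ℝ in atTop, -(ε * x) ≤ Real.log ‖(sensitivity G)⁻¹ x‖ := by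
  obtain ⟨n, hn⟩ := hG
  obtain ⟨c, hc, hcb⟩ := hn.exists_pos
  have h1 : Tendsto (fun x : ℝ => n * (Real.log x / x)) atTop (nhds 0) := by
    simpa using Real.isLittleO_log_id_atTop.tendsto_div_nhds_zero.const_mul (n : ℝ)
  filter_upwards [hcb.bound, h1.eventually (eventually_lt_nhds (show 0 < ε / 2 by positivity)),
    eventually_gt_atTop 0, eventually_gt_atTop (2 * |Real.log c| / ε)] with x e1 e2 e3 e4
  rw [Pi.inv_apply, norm_inv, Real.log_inv, neg_le_neg_iff]
  rw [← mul_div_assoc, div_lt_iff₀ e3] at e2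
  rw [div_lt_iff₀ hε] at e4
  rcases eq_or_ne ‖sensitivity G x‖ 0 with h0 | h0
  · rw [h0, Real.log_zero]
    positivity
  · have := Real.log_le_log (lt_of_le_of_ne (norm_nonneg _) (Ne.symm h0)) e1
    rw [norm_pow, Real.norm_eq_abs, abs_of_pos e3, Real.log_mul hc.ne' (by positivity),
      Real.log_pow] at this
    have := le_abs_self (Real.log c)
    linarith

/-- Near a zero of G, 1/(1 + G) tends to 1, and the normal form takes the limit as its value. -/
theorem sensitivity_eq_one_of_meromorphicOrderAt_pos {G : ℂ → ℂ} (hG : IsTransferFunction G) {ζ : ℂ}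
    (hζ : ζ ∈ closedRHP) (h : 0 < meromorphicOrderAt G ζ) : sensitivity G ζ = 1 := by
  have h1 : Tendsto (fun z => 1 / (1 + G z)) (nhdsWithin ζ {ζ}ᶜ) (nhds 1) := by
    have := ((tendsto_zero_of_meromorphicOrderAt_pos h).const_add 1).inv₀ (by norm_num)
    simpa using this
  have h2 : Tendsto (sensitivity G) (nhdsWithin ζ {ζ}ᶜ) (nhds 1) :=
    h1.congr' (hG.meromorphicOn_one_div_one_add.toMeromorphicNFOn_eq_self_on_nhdsNE hζ).symm
  have hnf := meromorphicNFOn_sensitivity G hζ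
  have h3 : 0 ≤ meromorphicOrderAt (sensitivity G) ζ :=
    (tendsto_nhds_iff_meromorphicOrderAt_nonneg hnf.meromorphicAt).1 ⟨1, h2⟩
  have h4 := (hnf.meromorphicOrderAt_nonneg_iff_analyticAt.1 h3).continuousAt
  exact tendsto_nhds_unique (h4.tendsto.mono_left nhdsWithin_le_nhds) h2

theorem ListsZeros.ne_of_meromorphicOrderAt_nonpos {f : ℂ → ℂ} {m : ℕ} {a : Fin m → ℂ}
    (h : ListsZeros f a) {s : ℂ} (hs : s ∈ openRHP) (hf : meromorphicOrderAt f s ≤ 0) (i : Fin m) :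
    s ≠ a i := fun hi => by
  have h1 := h.2 s hs
  rw [max_eq_right hf] at h1
  have h2 : Nat.card {i // a i = s} = 0 := by exact_mod_cast h1.symm
  have : Nonempty {i // a i = s} := ⟨⟨i, hi.symm⟩⟩
  exact Nat.card_pos.ne' h2

theorem theorem1 (G : ℂ → ℂ) (hG : IsTransferFunction G) (hwp : IsWellPosed G)
    {M N : ℕ} (α : Fin M → ℂ) (β : Fin N → ℂ)
    (hα : ListsZeros (sensitivity G) α) (hβ : ListsPoles (sensitivity G) β) :
    (∀ (σ η : ℝ) (s₀ : ℂ), 0 < σ → s₀ = (σ : ℂ) + (η : ℂ) * Complex.I →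
      (∀ i, s₀ ≠ α i) → (∀ i, s₀ ≠ β i) →
        Integrable (fun ω : ℝ => Real.log ‖sensitivity G ((ω : ℂ) * Complex.I)‖ *
          (σ / (σ ^ 2 + (ω - η) ^ 2))) ∧
        ∫ ω : ℝ, Real.log ‖sensitivity G ((ω : ℂ) * Complex.I)‖ *
            (σ / (σ ^ 2 + (ω - η) ^ 2)) =
          -Real.pi * (-Real.log ‖sensitivity G s₀‖ +
            ∑ i, Real.log ‖(s₀ - α i) / (s₀ + starRingEnd ℂ (α i))‖ +
            ∑ i, Real.log ‖(s₀ + starRingEnd ℂ (β i)) / (s₀ - β i)‖)) ∧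
    (∀ (σ η : ℝ) (ζ : ℂ), 0 < σ → ζ = (σ : ℂ) + (η : ℂ) * Complex.I →
      0 < meromorphicOrderAt G ζ →
        sensitivity G ζ = 1 ∧
        Integrable (fun ω : ℝ => Real.log ‖sensitivity G ((ω : ℂ) * Complex.I)‖ *
          (σ / (σ ^ 2 + (ω - η) ^ 2))) ∧
        ∫ ω : ℝ, Real.log ‖sensitivity G ((ω : ℂ) * Complex.I)‖ *
            (σ / (σ ^ 2 + (ω - η) ^ 2)) =
          -Real.pi * (∑ i, Real.log ‖(ζ - α i) / (ζ + starRingEnd ℂ (α i))‖ +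
            ∑ i, Real.log ‖(ζ + starRingEnd ℂ (β i)) / (ζ - β i)‖)) := by
  have hopen : ∀ (σ η : ℝ) (s : ℂ), 0 < σ → s = (σ : ℂ) + (η : ℂ) * Complex.I →
      s ∈ openRHP ∧ s.re = σ ∧ s.im = η := by
    rintro σ η s hσ rfl
    simp [openRHP, hσ]
  have hpart : ∀ (σ η : ℝ) (s₀ : ℂ), 0 < σ → s₀ = (σ : ℂ) + (η : ℂ) * Complex.I →
      (∀ i, s₀ ≠ α i) → (∀ i, s₀ ≠ β i) →
        Integrable (fun ω : ℝ => Real.log ‖sensitivity G ((ω : ℂ) * Complex.I)‖ *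
          (σ / (σ ^ 2 + (ω - η) ^ 2))) ∧
        ∫ ω : ℝ, Real.log ‖sensitivity G ((ω : ℂ) * Complex.I)‖ *
            (σ / (σ ^ 2 + (ω - η) ^ 2)) =
          -Real.pi * (-Real.log ‖sensitivity G s₀‖ +
            ∑ i, Real.log ‖(s₀ - α i) / (s₀ + starRingEnd ℂ (α i))‖ +
            ∑ i, Real.log ‖(s₀ + starRingEnd ℂ (β i)) / (s₀ - β i)‖) := by
    intro σ η s₀ hσ hs hsα hsβ
    obtain ⟨hs₀, hre, him⟩ := hopen σ η s₀ hσ hs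
    obtain ⟨n, C, R, hb⟩ := hG.exists_bound_sensitivity_inv
    -- Applied to f = g⁻¹: by definition of `ListsPoles`, β lists the zeros of f, and by `inv_inv` α
    -- lists those of f⁻¹.
    obtain ⟨hi, he⟩ := poisson_jensen_rightHalfPlane
      (meromorphicNFOn_inv.2 (meromorphicNFOn_sensitivity G)) hb
      (fun ε hε => hwp.eventually_le_log_norm_sensitivity_inv hε) hβ
      (by rwa [inv_inv]) hs₀ hsα hsβ
    simp only [Pi.inv_apply, norm_inv, Real.log_inv, neg_mul, hre, him] at hi he
    rw [integral_neg] at he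
    refine ⟨by simpa using hi.neg, ?_⟩
    have hβ' : ∀ i, Real.log ‖(s₀ + starRingEnd ℂ (β i)) / (s₀ - β i)‖ =
        -Real.log ‖blaschkeFactor (β i) s₀‖ := fun i => by
      rw [blaschkeFactor, ← Real.log_inv, ← norm_inv, inv_div]
    simp only [hβ', Finset.sum_neg_distrib]
    simp only [blaschkeFactor] at he ⊢
    linarith
  refine ⟨hpart, fun σ η ζ hσ hζ hord => ?_⟩
  obtain ⟨hζm, -, -⟩ := hopen σ η ζ hσ hζ
  have hζc := openRHP_subset_closedRHP hζm
  have hone := sensitivity_eq_one_of_meromorphicOrderAt_pos hG hζc hord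
  -- As g(ζ) = 1, the point ζ is neither a zero nor a pole of g, so the first part applies with
  -- log|g(ζ)| = 0.
  have hzero : meromorphicOrderAt (sensitivity G) ζ = 0 :=
    (meromorphicNFOn_sensitivity G hζc).meromorphicOrderAt_eq_zero_iff.2 (by simp [hone])
  have := hpart σ η ζ hσ hζ (hα.ne_of_meromorphicOrderAt_nonpos hζm hzero.le)
    (ListsZeros.ne_of_meromorphicOrderAt_nonpos hβ hζm (by rw [meromorphicOrderAt_inv, hzero]; simp))
  rw [hone, norm_one, Real.log_one, neg_zero, zero_add] at this
  exact ⟨hone, this⟩
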